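/- Let $\sigma_+>0$ and $\sigma_-<0$ be constants and put $\kappa_\sigma:=\sigma_- /\sigma_+$. For $\delta\in(0,1)$ consider the half-annulus $$\Omega^\delta:=\{(r\cos\theta,r\sin\theta)\mid \delta<r<1,\ 0<\theta<\pi\}$$ and its subdomains $\Omega^\delta_+$ (where $\pi/4<\theta<\pi$) and $\Omega^\delta_-$ (where $0<\theta<\pi/4$), and let $\sigma^\delta:=\sigma_\pm$ in $\Omega^\delta_\pm$. Let $H^1_0(\Omega^\delta)$ be the space of complex-valued $H^1$ functions on $\Omega^\delta$ that vanish on $\partial\Omega^\delta$, let $H^{-1}(\Omega^\delta)$ be the space of continuous antilinear forms on $H^1_0(\Omega^\delta)$, and let $A^\delta:H^1_0(\Omega^\delta)\to H^{-1}(\Omega^\delta)$ be the continuous linear operator given by $$\langle A^\delta u,v\rangle=\int_{\Omega^\delta}\sigma^\delta\,\nabla u\cdot\overline{\nabla v}\,d\mathbf{x},\qquad u,v\in H^1_0(\Omega^\delta).$$ (i) Suppose that $\kappa_\sigma\in(-1,-1/3)$, and for integers $n\ge 1$ set $$\delta^n:=\exp\left(-\frac{n\pi^2}{2\operatorname{acosh}\left(\frac{1-\kappa_\sigma}{2(1+\kappa_\sigma)}\right)}\right).$$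 Then $\delta^n\in(0,1)$ for all $n\ge1$, and $\delta^n\to0$ as $n\to\infty$. For every $\delta\in(0,1)$, the operator $A^\delta$ has a nontrivial kernel if and only if $\delta=\delta^n$ for some $n\ge1$, and $A^\delta$ is an isomorphism if and only if $\delta\ne\delta^n$ for all $n\ge1$. (ii) Suppose that $\kappa_\sigma\notin[-1,-1/3]$, that is, $\kappa_\sigma\in(-\infty,-1)\cup(-1/3,0)$. Then $A^\delta$ is injective for every $\delta\in(0,1)$. -/

import Mathlib

open MeasureTheory Set Filter Topology
open scoped ContDiff

noncomputable section

namespace HalfAnnulus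

/-! ### The spaces `H¹₀(Ω)` and `H⁻¹(Ω)` of a planar set -/

/-- Test functions `φ ∈ C_c^∞(Ω; ℂ)`. -/
structure IsTest (Ω : Set (ℝ × ℝ)) (φ : ℝ × ℝ → ℂ) : Prop where
  smooth : ContDiff ℝ ∞ φ
  compact : HasCompactSupport φ
  support : tsupport φ ⊆ Ω

/-- The classical gradient `(∂φ/∂x, ∂φ/∂y)`, with values in `ℂ²`. -/
def grad (φ : ℝ × ℝ → ℂ) (x : ℝ × ℝ) : EuclideanSpace ℂ (Fin 2) :=
  !₂[fderiv ℝ φ x (1, 0), fderiv ℝ φ x (0, 1)]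

/-- `L²(Ω; ℂ) × L²(Ω; ℂ²)` with its Hilbert norm `(‖u‖² + ‖p‖²)^(1/2)`. -/
abbrev Jets (Ω : Set (ℝ × ℝ)) : Type :=
  WithLp 2 (Lp ℂ 2 (volume.restrict Ω) × Lp (EuclideanSpace ℂ (Fin 2)) 2 (volume.restrict Ω))

/-- The pairs `(φ, ∇φ)`, where `φ` is a test function. -/
def testJets (Ω : Set (ℝ × ℝ)) : Submodule ℂ (Jets Ω) where
  carrier := {w | ∃ φ, IsTest Ω φ ∧ w.fst =ᵐ[volume.restrict Ω] φ ∧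
    w.snd =ᵐ[volume.restrict Ω] grad φ}
  zero_mem' := by
    refine ⟨0, ⟨contDiff_const, HasCompactSupport.zero, ?_⟩, Lp.coeFn_zero _ _ _, ?_⟩
    · simp [tsupport]
    · filter_upwards [Lp.coeFn_zero (EuclideanSpace ℂ (Fin 2)) 2 (volume.restrict Ω)] with x hx
      rw [WithLp.zero_snd, hx]
      ext i
      fin_cases i <;> simp [grad]
  add_mem' := by
    rintro u v ⟨φ, hφ, h1, h2⟩ ⟨ψ, hψ, h3, h4⟩
    refine ⟨φ + ψ, ⟨hφ.smooth.add hψ.smooth, hφ.compact.add hψ.compact, ?_⟩, ?_, ?_⟩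
    · exact (tsupport_add φ ψ).trans (union_subset hφ.support hψ.support)
    · rw [WithLp.add_fst]
      filter_upwards [Lp.coeFn_add u.fst v.fst, h1, h3] with x hx h h'
      rw [hx, Pi.add_apply, h, h', Pi.add_apply]
    · rw [WithLp.add_snd]
      filter_upwards [Lp.coeFn_add u.snd v.snd, h2, h4] with x hx h h'
      rw [hx, Pi.add_apply, h, h']
      have e := fderiv_add (hφ.smooth.differentiable (by simp) x)
        (hψ.smooth.differentiable (by simp) x)
      ext i
      fin_cases i <;> simp [grad, e]
  smul_mem' := by
    rintro c u ⟨φ, hφ, h1, h2⟩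
    refine ⟨c • φ, ⟨hφ.smooth.const_smul c, hφ.compact.smul_left (f := fun _ => c), ?_⟩, ?_, ?_⟩
    · exact (tsupport_smul_subset_right (fun _ => c) φ).trans hφ.support
    · rw [WithLp.smul_fst]
      filter_upwards [Lp.coeFn_smul c u.fst, h1] with x hx h
      simp [hx, h]
    · rw [WithLp.smul_snd]
      filter_upwards [Lp.coeFn_smul c u.snd, h2] with x hx h
      rw [hx, Pi.smul_apply, h]
      have e := fderiv_const_smul (hφ.smooth.differentiable (by simp) x) c
      ext i
      fin_cases i <;> simp [grad, e]

/-- `H¹₀(Ω)`, the closure of `C_c^∞(Ω; ℂ)` in the `H¹`-norm; an element `u` is stored as the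
pair of `u` (`u.1.fst`) and its weak gradient (`u.1.snd`). -/
abbrev H10 (Ω : Set (ℝ × ℝ)) : Type := (testJets Ω).topologicalClosure

/-- The weak gradient of an element of `H¹₀(Ω)`. -/
def wgrad {Ω : Set (ℝ × ℝ)} (u : H10 Ω) :
    Lp (EuclideanSpace ℂ (Fin 2)) 2 (volume.restrict Ω) := u.1.snd

/-- `H⁻¹(Ω)`, the space of continuous antilinear forms on `H¹₀(Ω)`. -/
abbrev HNeg1 (Ω : Set (ℝ × ℝ)) : Type := H10 Ω →L⋆[ℂ] ℂ

/-! ### The geometry -/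

/-- `{(r cos θ, r sin θ) | δ < r < 1, α < θ < β}` -/
def sector (δ α β : ℝ) : Set (ℝ × ℝ) :=
  (fun p : ℝ × ℝ => (p.1 * Real.cos p.2, p.1 * Real.sin p.2)) '' (Ioo δ 1 ×ˢ Ioo α β)

/-- `Ω^δ` -/
def dom (δ : ℝ) : Set (ℝ × ℝ) := sector δ 0 Real.pi

/-- `Ω₊^δ` -/
def domPos (δ : ℝ) : Set (ℝ × ℝ) := sector δ (Real.pi / 4) Real.pi

/-- `Ω₋^δ` -/
def domNeg (δ : ℝ) : Set (ℝ × ℝ) := sector δ 0 (Real.pi / 4)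

/-- The coefficient `σ^δ`, equal to `σ₊` in `Ω₊^δ` and to `σ₋` in `Ω₋^δ`. -/
def coeff (δ σp σm : ℝ) (x : ℝ × ℝ) : ℝ :=
  (domPos δ).indicator (fun _ => σp) x + (domNeg δ).indicator (fun _ => σm) x

theorem measurableSet_sector (δ α β : ℝ) : MeasurableSet (sector δ α β) := by
  have ho : IsOpen (Ioo δ 1 ×ˢ Ioo α β) := isOpen_Ioo.prod isOpen_Ioo
  have : LocallyCompactSpace ↥(Ioo δ 1 ×ˢ Ioo α β) := ho.locallyCompactSpace
  have hs : IsSigmaCompact (Ioo δ 1 ×ˢ Ioo α β) :=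
    isSigmaCompact_iff_sigmaCompactSpace.mpr inferInstance
  obtain ⟨K, hK, hU⟩ := hs.image
    (f := fun p : ℝ × ℝ => (p.1 * Real.cos p.2, p.1 * Real.sin p.2)) (by fun_prop)
  rw [sector, ← hU]
  exact MeasurableSet.iUnion fun n => (hK n).measurableSet

theorem measurable_coeff (δ σp σm : ℝ) : Measurable (coeff δ σp σm) :=
  (measurable_const.indicator (measurableSet_sector _ _ _)).add
    (measurable_const.indicator (measurableSet_sector _ _ _))

theorem abs_coeff_le (δ σp σm : ℝ) (x : ℝ × ℝ) : |coeff δ σp σm x| ≤ |σp| + |σm| := by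
  refine (abs_add_le _ _).trans (add_le_add ?_ ?_)
  · exact norm_indicator_le_norm_self (fun _ => σp) x
  · exact norm_indicator_le_norm_self (fun _ => σm) x

/-! ### The operator -/

/-- `(σ^δ ∇u, ∇v) = ∫_{Ω^δ} σ^δ ∇u · conj(∇v)`; the inner product `inner ℂ p q` of `ℂ²` is
antilinear in `p`. -/
def form (δ σp σm : ℝ) (u v : H10 (dom δ)) : ℂ :=
  ∫ x in dom δ, (coeff δ σp σm x : ℂ) * inner ℂ (wgrad v x) (wgrad u x)

theorem integrable_form (δ σp σm : ℝ) (u v : H10 (dom δ)) :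
    Integrable (fun x => (coeff δ σp σm x : ℂ) * inner ℂ (wgrad v x) (wgrad u x))
      (volume.restrict (dom δ)) := by
  refine (L2.integrable_inner (𝕜 := ℂ) (wgrad v) (wgrad u)).bdd_mul (c := |σp| + |σm|) ?_ ?_
  · exact (Complex.measurable_ofReal.comp (measurable_coeff δ σp σm)).aestronglyMeasurable
  · refine Eventually.of_forall fun x => ?_
    rw [Complex.norm_real]
    exact abs_coeff_le δ σp σm x

theorem norm_form_le (δ σp σm : ℝ) (u v : H10 (dom δ)) :
    ‖form δ σp σm u v‖ ≤ (|σp| + |σm|) * ‖u‖ * ‖v‖ := by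
  have hm : MemLp (fun x => (coeff δ σp σm x : ℂ) • wgrad u x) 2 (volume.restrict (dom δ)) := by
    refine MemLp.of_le_mul (c := |σp| + |σm|) (Lp.memLp (wgrad u)) ?_ ?_
    · exact (Complex.measurable_ofReal.comp
        (measurable_coeff δ σp σm)).aestronglyMeasurable.smul (Lp.aestronglyMeasurable _)
    · refine Eventually.of_forall fun x => ?_
      rw [norm_smul, Complex.norm_real]
      exact mul_le_mul_of_nonneg_right (abs_coeff_le δ σp σm x) (norm_nonneg _)
  have he : form δ σp σm u v = inner ℂ (wgrad v) (hm.toLp _) := by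
    rw [L2.inner_def, form]
    refine integral_congr_ae ?_
    filter_upwards [hm.coeFn_toLp] with x hx
    rw [hx, inner_smul_right]
  have hn : ‖hm.toLp _‖ ≤ (|σp| + |σm|) * ‖wgrad u‖ := by
    refine Lp.norm_le_mul_norm_of_ae_le_mul ?_
    filter_upwards [hm.coeFn_toLp] with x hx
    rw [hx, norm_smul, Complex.norm_real]
    exact mul_le_mul_of_nonneg_right (abs_coeff_le δ σp σm x) (norm_nonneg _)
  have hg : ∀ w : H10 (dom δ), ‖wgrad w‖ ≤ ‖w‖ := fun w => WithLp.norm_snd_le _ w.1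
  rw [he]
  calc ‖inner ℂ (wgrad v) (hm.toLp _)‖ ≤ ‖wgrad v‖ * ‖hm.toLp _‖ := norm_inner_le_norm _ _
    _ ≤ ‖v‖ * ((|σp| + |σm|) * ‖u‖) := by
        have := hg u
        have := hg v
        gcongr
        exact hn.trans (by gcongr)
    _ = _ := by ring

/-- The operator `A^δ : H¹₀(Ω^δ) → H⁻¹(Ω^δ)`, `⟨A^δ u, v⟩ = (σ^δ ∇u, ∇v)`. -/
def A (δ σp σm : ℝ) : H10 (dom δ) →L[ℂ] HNeg1 (dom δ) :=
  LinearMap.mkContinuous₂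
    (LinearMap.mk₂'ₛₗ (RingHom.id ℂ) (starRingEnd ℂ) (form δ σp σm)
      (by
        intro u u' v
        rw [form, form, form, ← integral_add (integrable_form ..) (integrable_form ..)]
        refine integral_congr_ae ?_
        filter_upwards [Lp.coeFn_add (wgrad u) (wgrad u')] with x hx
        change _ * inner ℂ _ ((wgrad u + wgrad u') x) = _
        rw [hx, Pi.add_apply, inner_add_right, mul_add])
      (by
        intro c u v
        rw [form, form, smul_eq_mul, ← integral_const_mul]
        refine integral_congr_ae ?_
        filter_upwards [Lp.coeFn_smul c (wgrad u)] with x hx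
        change _ * inner ℂ _ ((c • wgrad u) x) = _
        rw [hx, Pi.smul_apply, inner_smul_right, RingHom.id_apply]
        ring)
      (by
        intro u v v'
        rw [form, form, form, ← integral_add (integrable_form ..) (integrable_form ..)]
        refine integral_congr_ae ?_
        filter_upwards [Lp.coeFn_add (wgrad v) (wgrad v')] with x hx
        change _ * inner ℂ ((wgrad v + wgrad v') x) _ = _
        rw [hx, Pi.add_apply, inner_add_left, mul_add])
      (by
        intro c u v
        rw [form, form, smul_eq_mul, ← integral_const_mul]
        refine integral_congr_ae ?_
        filter_upwards [Lp.coeFn_smul c (wgrad v)] with x hx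
        change _ * inner ℂ ((c • wgrad v) x) _ = _
        rw [hx, Pi.smul_apply, inner_smul_left]
        ring))
    (|σp| + |σm|) (norm_form_le δ σp σm)

theorem A_apply (δ σp σm : ℝ) (u v : H10 (dom δ)) :
    A δ σp σm u v =
      ∫ x in dom δ, (coeff δ σp σm x : ℂ) * inner ℂ (wgrad v x) (wgrad u x) := rfl

/-- `δⁿ = exp(-nπ² / (2 acosh((1 - κ) / (2 (1 + κ)))))` -/
def critDelta (κ : ℝ) (n : ℕ) : ℝ :=
  Real.exp (-(n * Real.pi ^ 2 / (2 * Real.arcosh ((1 - κ) / (2 * (1 + κ))))))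

end HalfAnnulus

end

/-!
By Poincaré's inequality `A δ 1 1` is the operator of a scalar product on `H¹₀(Ω^δ)`, and relative
to it `A^δ` is diagonal. Functions supported in one of the two subdomains are eigenvectors, with
eigenvalues `σ₊` and `σ₋`. In the coordinates `(log r, θ)` the other eigenvectors are
`sin (μ log r) h(θ)`, where `μ = kπ / (-log δ)` with `k ≥ 1`, and `h` is continuous, vanishes at `0`
and `π`, and solves `h'' = μ² h` away from `π/4`; integrating by parts leaves only the flux through
the interface `θ = π/4`, which gives the eigenvalue
`l = (σ₊ + σ₋) / 2 - (σ₊ - σ₋) / (4 cosh (μ π / 2))`.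

Modulo functions supported in the subdomains each product `sin (μ log r) sin (j θ)` is a multiple of
one of these modes, so a function orthogonal to all eigenvectors integrates to zero against all such
products and vanishes, by the Weierstrass approximation theorem in the variables
`cos (π log r / log δ)` and `cos θ`. Hence `A^δ` is injective when no eigenvalue is zero, and
invertible when also their limit `(σ₊ + σ₋) / 2` is nonzero. Finally `l = 0` means
`cosh (μ π / 2) = (1 - κ) / (2 (1 + κ))`, which is solvable only for `-1 < κ < -1/3` and then gives
the critical radii.
-/

noncomputable section

namespace HalfAnnulus

open scoped NNReal

/-! ### Pencils of Hermitian forms -/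

section Pencil

variable {H : Type*} [NormedAddCommGroup H] [InnerProductSpace ℂ H] {T B : H →L[ℂ] H →L⋆[ℂ] ℂ}

/-- The eigenspace `{u | T u = l B u}` of the pencil of a pair of sesquilinear forms, stored as
operators to the antidual. -/
def pencilEigenspace (T B : H →L[ℂ] H →L⋆[ℂ] ℂ) (l : ℝ) : Submodule ℂ H :=
  (T - (l : ℂ) • B).ker

theorem mem_pencilEigenspace {l : ℝ} {u : H} :
    u ∈ pencilEigenspace T B l ↔ ∀ v, T u v = l * B u v := by
  simp only [pencilEigenspace, LinearMap.mem_ker, ContinuousLinearMap.coe_coe,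
    ContinuousLinearMap.ext_iff, sub_apply, smul_apply,
    smul_eq_mul, sub_eq_zero]

theorem apply_eq_zero_of_mem_pencilEigenspace (hT : ∀ u v, T u v = starRingEnd ℂ (T v u))
    (hB : ∀ u v, B u v = starRingEnd ℂ (B v u)) {l m : ℝ} (hlm : l ≠ m) {u v : H}
    (hu : u ∈ pencilEigenspace T B l) (hv : v ∈ pencilEigenspace T B m) : B u v = 0 := by
  have h : (l : ℂ) * B u v = m * B u v := by
    rw [← mem_pencilEigenspace.1 hu, hT, mem_pencilEigenspace.1 hv, map_mul, ← hB,
      Complex.conj_ofReal]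
  rw [← sub_eq_zero, ← sub_mul, mul_eq_zero, sub_eq_zero, Complex.ofReal_inj] at h
  exact h.resolve_left hlm

theorem injective_of_forall_pencilEigenspace (hT : ∀ u v, T u v = starRingEnd ℂ (T v u))
    (hB : ∀ u v, B u v = starRingEnd ℂ (B v u)) {Λ : Set ℝ} (hΛ : ∀ l ∈ Λ, l ≠ 0)
    (htot : ∀ u, (∀ l ∈ Λ, ∀ e ∈ pencilEigenspace T B l, B u e = 0) → u = 0) :
    Function.Injective T := by
  refine (injective_iff_map_eq_zero T).2 fun u hu => htot u fun l hl e he => ?_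
  have h : (l : ℂ) * B e u = 0 := by
    rw [← mem_pencilEigenspace.1 he, hT, hu, zero_apply, map_zero]
  rw [hB, (mul_eq_zero.1 h).resolve_left (Complex.ofReal_ne_zero.2 (hΛ l hl)), map_zero]

theorem apply_sum_smul_sum_smul {ι : Type*} (s : Finset ι) {w : ι → H}
    (hw : ∀ i j, i ≠ j → B (w i) (w j) = 0) (x y : ι → ℝ) :
    B (∑ i ∈ s, (x i : ℂ) • w i) (∑ i ∈ s, (y i : ℂ) • w i) =
      ∑ i ∈ s, ((x i * y i : ℝ) : ℂ) * B (w i) (w i) := by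
  simp only [map_sum, sum_apply, map_smulₛₗ, Complex.conj_ofReal, smul_apply, RingHom.id_apply,
    smul_eq_mul]
  refine Finset.sum_congr rfl fun i hi => ?_
  rw [Finset.sum_eq_single_of_mem i hi fun j _ hj => by rw [hw j i hj]; simp, ← mul_assoc,
    Complex.ofReal_mul, mul_comm (y i : ℂ)]

theorem mul_norm_le_of_mul_sq_le {a c t x y q : ℝ} (ha : 0 < a) (hc : 0 < c) (ht : 0 ≤ t)
    (hxq : a * x ^ 2 ≤ q) (hyq : a * y ^ 2 ≤ q) (hq : c * q ≤ t * y) :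
    c * a * x ≤ t := by
  have hca := mul_pos hc ha
  have hyt : c * a * y ≤ t := by
    by_contra! hlt
    have : 0 < y := pos_of_mul_pos_right (ht.trans_lt hlt) hca.le
    nlinarith
  refine le_of_sq_le_sq ?_ ht
  calc (c * a * x) ^ 2 = c ^ 2 * a * (a * x ^ 2) := by ring
    _ ≤ c ^ 2 * a * q := by gcongr
    _ = c * a * (c * q) := by ring
    _ ≤ c * a * (t * y) := by gcongr
    _ = t * (c * a * y) := by ring
    _ ≤ t * t := by gcongr
    _ = t ^ 2 := by ring

/-- In an expansion `u = ∑ w l` into eigenvectors, compare with `v = ∑ sign l • w l`: then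
`T u v = ∑ |l| B (w l) (w l) ≥ c B u u` and `B v v = B u u`. -/
theorem mul_norm_le_norm_apply_of_mem_iSup (hT : ∀ u v, T u v = starRingEnd ℂ (T v u))
    (hB : ∀ u v, B u v = starRingEnd ℂ (B v u)) {a c : ℝ} (ha : 0 < a) (hc : 0 < c)
    (hcoer : ∀ u, a * ‖u‖ ^ 2 ≤ (B u u).re) {Λ : Set ℝ} (hΛ : ∀ l ∈ Λ, c ≤ |l|) {u : H}
    (hu : u ∈ ⨆ l : Λ, pencilEigenspace T B l) : c * a * ‖u‖ ≤ ‖T u‖ := by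
  obtain ⟨w, hw, rfl⟩ := (Submodule.mem_iSup_iff_exists_finsupp _ _).1 hu
  set u := w.sum fun _ x => x
  set v := ∑ l ∈ w.support, ((SignType.sign (l : ℝ) : ℝ) : ℂ) • w l
  have hsum := apply_sum_smul_sum_smul w.support fun l m (hlm : l ≠ m) =>
    apply_eq_zero_of_mem_pencilEigenspace hT hB (Subtype.coe_injective.ne hlm) (hw l) (hw m)
  have hu1 : u = ∑ l ∈ w.support, ((1 : ℝ) : ℂ) • w l := by simp [u, Finsupp.sum]
  have hTuv : T u v = B (∑ l ∈ w.support, ((l : ℝ) : ℂ) • w l) v := by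
    simp only [u, Finsupp.sum, map_sum, sum_apply, mem_pencilEigenspace.1 (hw _), map_smul,
      smul_apply, smul_eq_mul]
  have hBvv : B v v = B u u := by
    rw [hu1, hsum, hsum]
    refine Finset.sum_congr rfl fun l _ => ?_
    rcases (abs_pos.1 (hc.trans_le (hΛ l l.2))).lt_or_gt with h | h <;> simp [h]
  have hlow : c * (B u u).re ≤ (T u v).re := by
    rw [hTuv, hu1, hsum, hsum, Complex.re_sum, Complex.re_sum, Finset.mul_sum]
    refine Finset.sum_le_sum fun l _ => ?_
    rw [Complex.re_ofReal_mul, Complex.re_ofReal_mul, mul_one, one_mul, self_mul_sign]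
    exact mul_le_mul_of_nonneg_right (hΛ l l.2) ((by positivity : (0 : ℝ) ≤ _).trans (hcoer (w l)))
  exact mul_norm_le_of_mul_sq_le ha hc (norm_nonneg _)
    (hcoer u) (hBvv ▸ hcoer v)
    (hlow.trans ((Complex.re_le_norm _).trans ((T u).le_opNorm v)))

theorem mul_norm_le_norm_apply_of_dense (hT : ∀ u v, T u v = starRingEnd ℂ (T v u))
    (hB : ∀ u v, B u v = starRingEnd ℂ (B v u)) {a c : ℝ} (ha : 0 < a) (hc : 0 < c)
    (hcoer : ∀ u, a * ‖u‖ ^ 2 ≤ (B u u).re) {Λ : Set ℝ} (hΛ : ∀ l ∈ Λ, c ≤ |l|)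
    (hd : (⨆ l : Λ, pencilEigenspace T B l).topologicalClosure = ⊤) (u : H) :
    c * a * ‖u‖ ≤ ‖T u‖ := by
  have hcl : IsClosed {u : H | c * a * ‖u‖ ≤ ‖T u‖} := isClosed_le (by fun_prop) (by fun_prop)
  refine hcl.closure_subset_iff.2
    (fun _ hu => mul_norm_le_norm_apply_of_mem_iSup hT hB ha hc hcoer hΛ hu) ?_
  rw [← Submodule.topologicalClosure_coe, hd]
  trivial

theorem surjective_innerSLFlip [CompleteSpace H] :
    Function.Surjective (innerSLFlip ℂ : H →L[ℂ] H →L⋆[ℂ] ℂ) := fun f => by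
  let g : H →L[ℂ] ℂ := (starL ℂ : ℂ ≃L⋆[ℂ] ℂ).toContinuousLinearMap.comp f
  refine ⟨(InnerProductSpace.toDual ℂ H).symm g, ContinuousLinearMap.ext fun v => ?_⟩
  rw [innerSLFlip_apply_apply, ← inner_conj_symm, InnerProductSpace.toDual_symm_apply]
  exact Complex.conj_conj (f v)

theorem isInvertible_of_forall_mul_norm_le [CompleteSpace H]
    (hT : ∀ u v, T u v = starRingEnd ℂ (T v u)) {c : ℝ} (hc : 0 < c)
    (h : ∀ u, c * ‖u‖ ≤ ‖T u‖) : T.IsInvertible := by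
  have hinj (u : H) (hu : T u = 0) : u = 0 := norm_le_zero_iff.1
    (le_of_mul_le_mul_left (by simpa only [hu, norm_zero, mul_zero] using h u) hc)
  let S : H →L[ℂ] H := InnerProductSpace.continuousLinearMapOfBilin T.flip
  have hS (u v : H) : inner ℂ (S u) v = T v u :=
    InnerProductSpace.continuousLinearMapOfBilin_apply _ u v
  have hTS (u : H) : ‖T u‖ ≤ ‖S u‖ := by
    refine ContinuousLinearMap.opNorm_le_bound _ (norm_nonneg _) fun v => ?_
    rw [hT, Complex.norm_conj, ← hS]
    exact norm_inner_le_norm (𝕜 := ℂ) (S u) v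
  have hanti : AntilipschitzWith (⟨c⁻¹, by positivity⟩ : NNReal) S :=
    S.antilipschitz_of_bound fun u => (le_inv_mul_iff₀ hc).2 ((h u).trans (hTS u))
  have hrange : S.range = ⊤ := by
    have hclosed : IsClosed (S.range : Set H) := hanti.isClosed_range S.uniformContinuous
    rw [← hclosed.submodule_topologicalClosure_eq, Submodule.topologicalClosure_eq_top_iff,
      Submodule.eq_bot_iff]
    refine fun z hz => hinj z (ContinuousLinearMap.ext fun v => ?_)
    rw [← hS]
    exact (Submodule.mem_orthogonal _ _).1 hz (S v) ⟨v, rfl⟩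
  have hsurj : Function.Surjective T := fun f => by
    obtain ⟨z, rfl⟩ := surjective_innerSLFlip f
    obtain ⟨u, rfl⟩ := LinearMap.range_eq_top.1 hrange z
    refine ⟨u, ContinuousLinearMap.ext fun v => ?_⟩
    rw [hT, ← hS, inner_conj_symm]
    rfl
  exact ⟨.ofBijective T (LinearMap.ker_eq_bot'.2 hinj) (LinearMap.range_eq_top.2 hsurj),
    ContinuousLinearEquiv.coe_ofBijective _ _ _⟩

theorem topologicalClosure_iSup_pencilEigenspace [CompleteSpace H]
    (hsurj : Function.Surjective B) {Λ : Set ℝ}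
    (htot : ∀ u, (∀ l ∈ Λ, ∀ e ∈ pencilEigenspace T B l, B u e = 0) → u = 0) :
    (⨆ l : Λ, pencilEigenspace T B l).topologicalClosure = ⊤ := by
  rw [Submodule.topologicalClosure_eq_top_iff, Submodule.eq_bot_iff]
  intro z hz
  obtain ⟨u, hu⟩ := hsurj (innerSLFlip ℂ z)
  have h0 : u = 0 := htot u fun l hl e he => by
    rw [hu, innerSLFlip_apply_apply]
    exact (Submodule.mem_orthogonal _ _).1 hz e (Submodule.mem_iSup_of_mem ⟨l, hl⟩ he)
  have hz0 : inner ℂ z z = (0 : ℂ) := by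
    rw [← innerSLFlip_apply_apply ℂ, ← hu, h0, map_zero, zero_apply]
  exact inner_self_eq_zero.1 hz0

end Pencil

/-! ### Completeness of the sines -/

section Sines

variable {X E : Type*} [MeasurableSpace X] [NormedAddCommGroup E] [NormedSpace ℝ E]
  {μ : Measure X} {g : X → E} {a b : X → ℝ}

theorem sin_succ_mul_mul_cos (k : ℕ) (x : ℝ) : Real.cos x * Real.sin ((k + 1 : ℕ) * x) =
    2⁻¹ * (Real.sin ((k + 2 : ℕ) * x) + Real.sin (k * x)) := by
  have h₁ : ((k + 2 : ℕ) : ℝ) * x = (k + 1 : ℕ) * x + x := by push_cast; ring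
  have h₂ : (k : ℝ) * x = (k + 1 : ℕ) * x - x := by push_cast; ring
  rw [h₁, h₂, Real.sin_add, Real.sin_sub]
  ring

/-- `F (cos a, cos b)` times any product of sines of multiples of `a` and `b` annihilates `g`. -/
def AnnihilatesSines (μ : Measure X) (g : X → E) (a b : X → ℝ) (F : C(ℝ × ℝ, ℝ)) : Prop :=
  ∀ k j : ℕ, ∫ x, (F (Real.cos (a x), Real.cos (b x)) *
    (Real.sin (k * a x) * Real.sin (j * b x))) • g x ∂μ = 0

theorem integrable_comp_cos_mul_sin_smul (hg : Integrable g μ) (ha : Measurable a)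
    (hb : Measurable b) (F : C(ℝ × ℝ, ℝ)) (k j : ℝ) :
    Integrable (fun x => (F (Real.cos (a x), Real.cos (b x)) *
      (Real.sin (k * a x) * Real.sin (j * b x))) • g x) μ := by
  obtain ⟨C, hC⟩ := (isCompact_Icc.prod isCompact_Icc).exists_bound_of_continuousOn
    (s := Icc (-1) 1 ×ˢ Icc (-1) 1) F.continuous.continuousOn
  refine hg.bdd_smul C (Measurable.aestronglyMeasurable ?_) (Eventually.of_forall fun x => ?_)
  · exact (F.continuous.measurable.comp (by fun_prop)).mul (by fun_prop)
  · rw [norm_mul, norm_mul, ← mul_one C, ← mul_one (1 : ℝ)]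
    have hF := hC _ (mk_mem_prod (Real.cos_mem_Icc (a x)) (Real.cos_mem_Icc (b x)))
    have hC0 := (norm_nonneg _).trans hF
    gcongr
    · exact Real.abs_sin_le_one _
    · exact Real.abs_sin_le_one _

theorem norm_integral_comp_cos_mul_sin_smul_sub_le (hg : Integrable g μ) (ha : Measurable a)
    (hb : Measurable b) {F G : C(ℝ × ℝ, ℝ)} {ε : ℝ}
    (h : ∀ p ∈ Icc (-1 : ℝ) 1 ×ˢ Icc (-1 : ℝ) 1, ‖G p - F p‖ ≤ ε) (k j : ℝ) :
    ‖∫ x, (G (Real.cos (a x), Real.cos (b x)) *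
        (Real.sin (k * a x) * Real.sin (j * b x))) • g x ∂μ -
      ∫ x, (F (Real.cos (a x), Real.cos (b x)) *
        (Real.sin (k * a x) * Real.sin (j * b x))) • g x ∂μ‖ ≤ ε * ∫ x, ‖g x‖ ∂μ := by
  rw [← integral_sub (integrable_comp_cos_mul_sin_smul hg ha hb G k j)
    (integrable_comp_cos_mul_sin_smul hg ha hb F k j), ← integral_const_mul]
  refine norm_integral_le_of_norm_le (hg.norm.const_mul ε) (Eventually.of_forall fun x => ?_)
  rw [← sub_smul, ← sub_mul, norm_smul, norm_mul, norm_mul]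
  have hFG := h _ (mk_mem_prod (Real.cos_mem_Icc (a x)) (Real.cos_mem_Icc (b x)))
  have hε := (norm_nonneg _).trans hFG
  gcongr
  calc _ ≤ ε * (1 * 1) := by
        gcongr
        · exact Real.abs_sin_le_one _
        · exact Real.abs_sin_le_one _
    _ = ε := by ring

namespace AnnihilatesSines

variable {F G : C(ℝ × ℝ, ℝ)}

theorem add (hg : Integrable g μ) (ha : Measurable a) (hb : Measurable b)
    (hF : AnnihilatesSines μ g a b F) (hG : AnnihilatesSines μ g a b G) :
    AnnihilatesSines μ g a b (F + G) := fun k j => by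
  simp only [ContinuousMap.add_apply, add_mul, add_smul]
  rw [integral_add (integrable_comp_cos_mul_sin_smul hg ha hb F k j)
    (integrable_comp_cos_mul_sin_smul hg ha hb G k j), hF, hG, add_zero]

theorem smul (c : ℝ) (hF : AnnihilatesSines μ g a b F) :
    AnnihilatesSines μ g a b (c • F) := fun k j => by
  simp only [ContinuousMap.smul_apply, smul_eq_mul, mul_assoc, mul_smul c]
  rw [integral_smul]
  simp only [hF k j, smul_zero]

theorem fst_mul (hg : Integrable g μ) (ha : Measurable a) (hb : Measurable b)
    (hF : AnnihilatesSines μ g a b F) :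
    AnnihilatesSines μ g a b (⟨Prod.fst, continuous_fst⟩ * F) := fun k j => by
  rcases k with - | k
  · simp
  have h := integral_add (integrable_comp_cos_mul_sin_smul hg ha hb F (k + 2 : ℕ) j)
    (integrable_comp_cos_mul_sin_smul hg ha hb F k j)
  rw [hF, hF, add_zero] at h
  rw [← smul_zero (2⁻¹ : ℝ), ← h, ← integral_smul]
  refine integral_congr_ae (Eventually.of_forall fun x => ?_)
  simp only [ContinuousMap.mul_apply, ContinuousMap.coe_mk, ← add_smul, smul_smul]
  congr 1
  linear_combination F (Real.cos (a x), Real.cos (b x)) * Real.sin (j * b x) *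
    sin_succ_mul_mul_cos k (a x)

theorem snd_mul (hg : Integrable g μ) (ha : Measurable a) (hb : Measurable b)
    (hF : AnnihilatesSines μ g a b F) :
    AnnihilatesSines μ g a b (⟨Prod.snd, continuous_snd⟩ * F) := fun k j => by
  rcases j with - | j
  · simp
  have h := integral_add (integrable_comp_cos_mul_sin_smul hg ha hb F k (j + 2 : ℕ))
    (integrable_comp_cos_mul_sin_smul hg ha hb F k j)
  rw [hF, hF, add_zero] at h
  rw [← smul_zero (2⁻¹ : ℝ), ← h, ← integral_smul]
  refine integral_congr_ae (Eventually.of_forall fun x => ?_)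
  simp only [ContinuousMap.mul_apply, ContinuousMap.coe_mk, ← add_smul, smul_smul]
  congr 1
  linear_combination F (Real.cos (a x), Real.cos (b x)) * Real.sin (k * a x) *
    sin_succ_mul_mul_cos j (b x)

end AnnihilatesSines

/-- The multipliers of the space of annihilators form an algebra containing both coordinates, hence
are dense by Stone–Weierstrass. -/
theorem integral_comp_cos_mul_sin_smul_eq_zero (hg : Integrable g μ) (ha : Measurable a)
    (hb : Measurable b)
    (h : ∀ k j : ℕ, ∫ x, (Real.sin (k * a x) * Real.sin (j * b x)) • g x ∂μ = 0)
    (F : C(ℝ × ℝ, ℝ)) :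
    ∫ x, (F (Real.cos (a x), Real.cos (b x)) * (Real.sin (a x) * Real.sin (b x))) • g x ∂μ = 0 := by
  let 𝒜 : Subalgebra ℝ C(ℝ × ℝ, ℝ) :=
    { carrier := {F | ∀ G, AnnihilatesSines μ g a b G → AnnihilatesSines μ g a b (F * G)}
      mul_mem' := fun {F F'} hF hF' G hG => by simpa only [mul_assoc] using hF _ (hF' G hG)
      add_mem' := fun {F F'} hF hF' G hG => by
        simpa only [add_mul] using (hF G hG).add hg ha hb (hF' G hG)
      algebraMap_mem' := fun c G hG => by
        simpa only [Algebra.algebraMap_eq_smul_one, smul_mul_assoc, one_mul] using hG.smul c }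
  have hsep : 𝒜.SeparatesPoints := by
    intro p q hpq
    rcases not_and_or.1 (mt Prod.ext_iff.2 hpq) with h | h
    · exact ⟨_, ⟨⟨Prod.fst, continuous_fst⟩, fun G hG => hG.fst_mul hg ha hb, rfl⟩, h⟩
    · exact ⟨_, ⟨⟨Prod.snd, continuous_snd⟩, fun G hG => hG.snd_mul hg ha hb, rfl⟩, h⟩
  have h1 : AnnihilatesSines μ g a b 1 := fun k j => by simpa using h k j
  have hC : 0 ≤ ∫ x, ‖g x‖ ∂μ := integral_nonneg fun x => norm_nonneg _
  refine norm_le_zero_iff.1 (le_of_forall_pos_le_add fun ε hε => ?_)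
  obtain ⟨G, hG, hFG⟩ :=
    ContinuousMap.exists_mem_subalgebra_near_continuous_of_isCompact_of_separatesPoints hsep F
      (isCompact_Icc.prod isCompact_Icc) (by positivity : 0 < ε / (∫ x, ‖g x‖ ∂μ + 1))
  have hle := norm_integral_comp_cos_mul_sin_smul_sub_le hg ha hb (fun p hp => (hFG p hp).le) 1 1
  have hG0 := hG 1 h1 1 1
  simp only [mul_one, Nat.cast_one, one_mul] at hG0 hle
  rw [hG0, zero_sub, norm_neg] at hle
  refine hle.trans ?_
  rw [zero_add, div_mul_comm]
  exact mul_le_of_le_one_left hε.le ((div_le_one (by positivity)).2 (by linarith))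

end Sines

/-! ### Approximation of Lipschitz functions -/

section LipschitzApprox

open scoped Convolution

variable {E : Type*} [NormedAddCommGroup E] [NormedSpace ℝ E] {K : ℝ≥0} {W : E → ℝ}

/-- Soft thresholding: `t` is moved by `ε` towards `0`, and sent to `0` if `|t| ≤ ε`. -/
def softThreshold (ε t : ℝ) : ℝ := t - max (-ε) (min ε t)

theorem lipschitzWith_softThreshold (ε : ℝ) : LipschitzWith 1 (softThreshold ε) := by
  refine LipschitzWith.of_dist_le_mul fun s t => ?_
  simp only [softThreshold, Real.dist_eq, NNReal.coe_one, one_mul]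
  grind

theorem abs_softThreshold_le {ε : ℝ} (hε : 0 ≤ ε) (t : ℝ) : |softThreshold ε t| ≤ |t| := by
  simp only [softThreshold]
  grind

theorem softThreshold_of_abs_le {ε t : ℝ} (h : |t| ≤ ε) : softThreshold ε t = 0 := by
  rw [abs_le] at h
  rw [softThreshold, min_eq_right h.2, max_eq_right h.1, sub_self]

theorem abs_softThreshold_sub_le {ε : ℝ} (hε : 0 ≤ ε) (t : ℝ) : |softThreshold ε t - t| ≤ ε := by
  simp only [softThreshold]
  grind

theorem eventually_softThreshold_eq_sub {ε t : ℝ} (hε : 0 ≤ ε) (h : ε < |t|) :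
    ∃ c, ∀ᶠ s in 𝓝 t, softThreshold ε s = s - c := by
  rcases lt_abs.1 h with ht | ht
  · refine ⟨ε, (eventually_gt_nhds ht).mono fun s hs => ?_⟩
    simp only [softThreshold]
    grind
  · refine ⟨-ε, (eventually_lt_nhds (lt_neg.1 ht)).mono fun s hs => ?_⟩
    simp only [softThreshold]
    grind

theorem fderiv_softThreshold_comp {ε : ℝ} {x : E} (hε : 0 ≤ ε) (hW : Continuous W)
    (h : ε < |W x|) : fderiv ℝ (softThreshold ε ∘ W) x = fderiv ℝ W x := by
  obtain ⟨c, hc⟩ := eventually_softThreshold_eq_sub hε h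
  have heq : softThreshold ε ∘ W =ᶠ[𝓝 x] fun y => W y - c := hW.continuousAt.eventually hc
  rw [heq.fderiv_eq, fderiv_sub_const]

theorem tendsto_softThreshold {ε : ℕ → ℝ} (hε : Tendsto ε atTop (𝓝 0)) (h0 : ∀ n, 0 ≤ ε n)
    (t : ℝ) : Tendsto (fun n => softThreshold (ε n) t) atTop (𝓝 t) :=
  tendsto_iff_dist_tendsto_zero.2 <|
    squeeze_zero (fun _ => dist_nonneg) (fun n => abs_softThreshold_sub_le (h0 n) t) hε

variable [FiniteDimensional ℝ E] [MeasurableSpace E] [BorelSpace E] {μ : Measure E}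
  [μ.IsAddHaarMeasure]

/-- Bounded convergence of functions with a common Lipschitz constant, together with the
almost everywhere convergence of their derivatives. -/
structure TendstoLipschitz (μ : Measure E) (K : ℝ≥0) (V : ℕ → E → ℝ) (W : E → ℝ) : Prop where
  lipschitz : ∀ n, LipschitzWith K (V n)
  bounded : ∃ C, ∀ n x, |V n x| ≤ C
  tendsto : ∀ x, Tendsto (fun n => V n x) atTop (𝓝 (W x))
  ae_tendsto_fderiv :
    ∀ᵐ x ∂μ, Tendsto (fun n => fderiv ℝ (V n) x) atTop (𝓝 (fderiv ℝ W x))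

theorem norm_normed_convolution_le {F : Type*} [NormedAddCommGroup F] [NormedSpace ℝ F]
    (ρ : ContDiffBump (0 : E)) {g : E → F} {C : ℝ}
    (hg : ∀ x, ‖g x‖ ≤ C) (x : E) :
    ‖(ρ.normed μ ⋆[ContinuousLinearMap.lsmul ℝ ℝ, μ] g) x‖ ≤ C := by
  calc _ ≤ ∫ t, ρ.normed μ t * C ∂μ :=
        norm_integral_le_of_norm_le (ρ.integrable_normed.mul_const C) <|
          Eventually.of_forall fun t => by
            rw [ContinuousLinearMap.lsmul_apply, norm_smul,
              Real.norm_of_nonneg (ρ.nonneg_normed t)]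
            exact mul_le_mul_of_nonneg_left (hg _) (ρ.nonneg_normed t)
    _ = C := by rw [integral_mul_const, ρ.integral_normed, one_mul]

theorem hasFDerivAt_normed_convolution (ρ : ContDiffBump (0 : E)) (hW : LipschitzWith K W)
    (x : E) : HasFDerivAt (ρ.normed μ ⋆[ContinuousLinearMap.lsmul ℝ ℝ, μ] W)
      ((ρ.normed μ ⋆[ContinuousLinearMap.lsmul ℝ ℝ, μ] fderiv ℝ W) x) x := by
  have hcont (y : E) : Continuous fun t => ρ.normed μ t • W (y - t) :=
    ρ.continuous_normed.smul (hW.continuous.comp (by fun_prop))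
  refine (hasFDerivAt_integral_of_dominated_loc_of_lip (s := univ)
    (bound := fun t => ρ.normed μ t * K) (F' := fun t => ρ.normed μ t • fderiv ℝ W (x - t))
    univ_mem ?_ ?_ ?_ ?_ ?_ ?_).2
  · exact Eventually.of_forall fun y => (hcont y).aestronglyMeasurable
  · exact (hcont x).integrable_of_hasCompactSupport ρ.hasCompactSupport_normed.smul_right
  · exact ρ.continuous_normed.aestronglyMeasurable.smul
      ((measurable_fderiv ℝ W).comp (by fun_prop)).aestronglyMeasurable
  · refine Eventually.of_forall fun t =>
      (LipschitzWith.of_dist_le_mul fun y z => ?_).lipschitzOnWith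
    rw [Real.coe_nnabs, abs_of_nonneg (mul_nonneg (ρ.nonneg_normed t) K.coe_nonneg)]
    change dist (ρ.normed μ t * W (y - t)) (ρ.normed μ t * W (z - t)) ≤ _
    rw [Real.dist_eq, ← mul_sub, abs_mul, abs_of_nonneg (ρ.nonneg_normed t), mul_assoc]
    gcongr
    · exact ρ.nonneg_normed t
    · simpa [Real.dist_eq] using hW.dist_le_mul (y - t) (z - t)
  · exact ρ.integrable_normed.mul_const _
  · have hd := hW.ae_differentiableAt (μ := μ)
    have hq : Measure.QuasiMeasurePreserving (fun t => x - t) μ μ :=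
      (Measure.measurePreserving_sub_left μ x).quasiMeasurePreserving
    filter_upwards [hq.ae hd] with t ht
    exact ((ht.hasFDerivAt.comp x ((hasFDerivAt_id x).sub_const t)).const_smul _)

theorem exists_contDiff_approx {Ω : Set E} (hΩ : IsOpen Ω) (hW : LipschitzWith K W)
    (hc : HasCompactSupport W) (hsub : tsupport W ⊆ Ω) :
    ∃ φ : ℕ → E → ℝ, TendstoLipschitz μ K φ W ∧
      ∀ n, ContDiff ℝ ∞ (φ n) ∧ HasCompactSupport (φ n) ∧ tsupport (φ n) ⊆ Ω := by
  obtain ⟨C, hC⟩ := hW.continuous.bounded_above_of_compact_support hc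
  obtain ⟨d, hd, hdΩ⟩ := IsCompact.exists_cthickening_subset_open hc hΩ hsub
  let ρ (n : ℕ) : ContDiffBump (0 : E) :=
    ⟨d / (n + 1) / 2, d / (n + 1), by positivity, half_lt_self (by positivity)⟩
  have hρ : Tendsto (fun n => (ρ n).rOut) atTop (𝓝 0) := by
    simpa [ρ, div_eq_mul_inv] using (tendsto_one_div_add_atTop_nhds_zero_nat (𝕜 := ℝ)).const_mul d
  have hρd (n : ℕ) : (ρ n).rOut ≤ d := div_le_self hd.le (by simp)
  have hderiv (n : ℕ) := hasFDerivAt_normed_convolution (μ := μ) (ρ n) hW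
  refine ⟨fun n => (ρ n).normed μ ⋆[ContinuousLinearMap.lsmul ℝ ℝ, μ] W,
    ⟨fun n => ?_, ⟨C, fun n => norm_normed_convolution_le (ρ n) hC⟩,
      ContDiffBump.convolution_tendsto_right_of_continuous hρ hW.continuous, ?_⟩,
    fun n => ⟨?_, (ρ n).hasCompactSupport_normed.convolution _ hc, ?_⟩⟩
  · refine lipschitzWith_of_nnnorm_fderiv_le (fun x => (hderiv n x).differentiableAt) fun x => ?_
    rw [(hderiv n x).fderiv]
    exact norm_normed_convolution_le (ρ n) (fun y => norm_fderiv_le_of_lipschitz ℝ hW) x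
  · simp only [(hderiv _ _).fderiv]
    refine ContDiffBump.ae_convolution_tendsto_right_of_locallyIntegrable (K := 2) hρ
      (Eventually.of_forall fun n => (mul_div_cancel₀ _ two_ne_zero).ge) ?_
    exact (memLp_top_of_bound (measurable_fderiv ℝ W).aestronglyMeasurable K
      (Eventually.of_forall fun y => norm_fderiv_le_of_lipschitz ℝ hW)).locallyIntegrable le_top
  · exact (ρ n).hasCompactSupport_normed.contDiff_convolution_left _ (ρ n).contDiff_normed
      hW.continuous.locallyIntegrable
  · refine (closure_minimal (fun x hx => ?_) Metric.isClosed_cthickening).trans hdΩ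
    obtain ⟨y, hy, z, hz, rfl⟩ := support_convolution_subset _ hx
    rw [(ρ n).support_normed_eq, mem_ball_zero_iff] at hy
    refine Metric.mem_cthickening_of_dist_le _ z d _ (subset_tsupport _ hz) ?_
    simpa using hy.le.trans (hρd n)

theorem ae_fderiv_eq_zero_of_eq_zero (hW : LipschitzWith K W) :
    ∀ᵐ x ∂μ, W x = 0 → fderiv ℝ W x = 0 := by
  rcases subsingleton_or_nontrivial E with _ | _
  · exact Eventually.of_forall fun x _ => Subsingleton.elim _ _
  obtain ⟨v, hv⟩ := exists_ne (0 : E)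
  let s : Set E := {x | W x = 0} ∩ {x | DifferentiableAt ℝ W x}
  have hs : MeasurableSet s := (isClosed_singleton.preimage hW.continuous).measurableSet.inter
    (measurableSet_of_differentiableAt ℝ W)
  have h0 : ApproximatesLinearOn (fun x => W x • v) (0 : E →L[ℝ] E) s 0 := fun x hx y hy => by
    simp [show W x = 0 from hx.1, show W y = 0 from hy.1]
  have hae := h0.norm_fderiv_sub_le μ hs (fun x => (fderiv ℝ W x).smulRight v)
    fun x hx => (hx.2.hasFDerivAt.smul_const v).hasFDerivWithinAt
  filter_upwards [(ae_restrict_iff' hs).1 hae, hW.ae_differentiableAt (μ := μ)] with x hx hd hWx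
  have hsmul : fderiv ℝ W x = 0 ∨ v = 0 := by simpa using hx ⟨hWx, hd⟩
  exact hsmul.resolve_right hv

theorem ae_tendsto_fderiv_softThreshold_comp {ε : ℕ → ℝ} (hε : Tendsto ε atTop (𝓝 0))
    (h0 : ∀ n, 0 ≤ ε n) (hW : LipschitzWith K W) :
    ∀ᵐ x ∂μ, Tendsto (fun n => fderiv ℝ (softThreshold (ε n) ∘ W) x) atTop
      (𝓝 (fderiv ℝ W x)) := by
  have hzero := ae_all_iff.2 fun n =>
    ae_fderiv_eq_zero_of_eq_zero (μ := μ) ((lipschitzWith_softThreshold (ε n)).comp hW)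
  filter_upwards [hzero, ae_fderiv_eq_zero_of_eq_zero (μ := μ) hW] with x hx hx'
  refine tendsto_const_nhds.congr' ?_
  by_cases hWx : W x = 0
  · refine Eventually.of_forall fun n => ?_
    exact (hx' hWx).trans (hx n (softThreshold_of_abs_le (by simpa [hWx] using h0 n))).symm
  · filter_upwards [hε.eventually_lt_const (abs_pos.2 hWx)] with n hn
    exact (fderiv_softThreshold_comp (h0 n) hW.continuous hn).symm

theorem exists_compactSupport_approx {Ω : Set E} (hΩ : Bornology.IsBounded Ω)
    (hW : LipschitzWith K W) (hzero : ∀ x ∉ Ω, W x = 0) :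
    ∃ V : ℕ → E → ℝ, TendstoLipschitz μ K V W ∧
      ∀ n, HasCompactSupport (V n) ∧ tsupport (V n) ⊆ Ω := by
  obtain ⟨C, hC⟩ := hW.continuous.bounded_above_of_compact_support <|
    Metric.isCompact_of_isClosed_isBounded (isClosed_tsupport W) <| hΩ.closure.subset <|
      closure_mono fun x hx => by_contra fun hxΩ => hx (hzero x hxΩ)
  let ε (n : ℕ) : ℝ := 1 / (n + 1)
  have hε : Tendsto ε atTop (𝓝 0) := tendsto_one_div_add_atTop_nhds_zero_nat
  have hpos (n : ℕ) : 0 < ε n := Nat.one_div_pos_of_nat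
  have hsupp (n : ℕ) : tsupport (softThreshold (ε n) ∘ W) ⊆ {x | ε n ≤ |W x|} := by
    refine closure_minimal (fun x hx => ?_)
      (isClosed_le continuous_const hW.continuous.abs)
    by_contra hlt
    exact hx (softThreshold_of_abs_le (not_le.1 hlt).le)
  have hsub (n : ℕ) : tsupport (softThreshold (ε n) ∘ W) ⊆ Ω := fun x hx => by
    by_contra hxΩ
    have hle : ε n ≤ |W x| := hsupp n hx
    rw [hzero x hxΩ, abs_zero] at hle
    exact (hpos n).not_ge hle
  refine ⟨fun n => softThreshold (ε n) ∘ W,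
    ⟨fun n => by simpa using (lipschitzWith_softThreshold (ε n)).comp hW,
      ⟨C, fun n x => (abs_softThreshold_le (hpos n).le _).trans (hC x)⟩,
      fun x => tendsto_softThreshold hε (fun n => (hpos n).le) _,
      ae_tendsto_fderiv_softThreshold_comp hε (fun n => (hpos n).le) hW⟩,
    fun n => ⟨?_, hsub n⟩⟩
  exact Metric.isCompact_of_isClosed_isBounded (isClosed_tsupport _) (hΩ.subset (hsub n))

end LipschitzApprox

/-! ### The space `H¹₀(Ω)` -/

section LpLimit

open scoped ENNReal

variable {X F : Type*} [MeasurableSpace X] {μ : Measure X} [IsFiniteMeasure μ]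
  [NormedAddCommGroup F] {p : ℝ≥0∞}

theorem exists_tendsto_Lp_of_ae_tendsto [Fact (1 ≤ p)] (hp : p ≠ ⊤) {f : ℕ → Lp F p μ} {g : X → F}
    {M : ℝ} (hM : ∀ n, ∀ᵐ x ∂μ, ‖f n x‖ ≤ M)
    (hlim : ∀ᵐ x ∂μ, Tendsto (fun n => f n x) atTop (𝓝 (g x))) :
    ∃ G : Lp F p μ, G =ᵐ[μ] g ∧ Tendsto f atTop (𝓝 G) := by
  have hg : MemLp g p μ := by
    refine MemLp.of_bound
      (aestronglyMeasurable_of_tendsto_ae atTop (fun n => Lp.aestronglyMeasurable (f n)) hlim) M ?_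
    filter_upwards [ae_all_iff.2 hM, hlim] with x hx hl
    exact le_of_tendsto' hl.norm hx
  have hui : UnifIntegrable (fun n => (f n : X → F)) p μ := by
    refine unifIntegrable_of (Fact.out : 1 ≤ p) hp (fun n => Lp.aestronglyMeasurable (f n))
      fun ε _ => ⟨Real.toNNReal M + 1, fun n => ?_⟩
    refine (eLpNorm_congr_ae (g := 0) ?_).trans_le (by simp)
    filter_upwards [hM n] with x hx
    refine indicator_of_notMem (fun hle => ?_) _
    have hle' : (Real.toNNReal M : ℝ) + 1 ≤ ‖f n x‖ := by exact_mod_cast hle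
    linarith [Real.le_coe_toNNReal M]
  exact ⟨hg.toLp g, hg.coeFn_toLp, Lp.tendsto_Lp_of_tendsto_eLpNorm g hg <|
    tendsto_Lp_finite_of_tendsto_ae Fact.out hp (fun n => Lp.aestronglyMeasurable (f n)) hg hui
      hlim⟩

end LpLimit

variable {Ω : Set (ℝ × ℝ)}

theorem continuous_grad {φ : ℝ × ℝ → ℂ} (hφ : ContDiff ℝ ∞ φ) : Continuous (grad φ) := by
  have h : Continuous (fderiv ℝ φ) := hφ.continuous_fderiv (by simp)
  refine (PiLp.continuous_toLp 2 _).comp (continuous_pi fun i => ?_)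
  fin_cases i
  · exact h.clm_apply continuous_const
  · exact h.clm_apply continuous_const

theorem hasCompactSupport_grad {φ : ℝ × ℝ → ℂ} (hφ : HasCompactSupport φ) :
    HasCompactSupport (grad φ) := by
  refine (hφ.fderiv (𝕜 := ℝ)).mono' fun x hx => subset_tsupport _ fun h0 => hx ?_
  ext i
  fin_cases i <;> simp [grad, h0]

theorem memLp_two_of_isTest {φ : ℝ × ℝ → ℂ} (hφ : IsTest Ω φ) :
    MemLp φ 2 (volume.restrict Ω) :=
  hφ.smooth.continuous.memLp_of_hasCompactSupport hφ.compact

theorem memLp_two_grad_of_isTest {φ : ℝ × ℝ → ℂ} (hφ : IsTest Ω φ) :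
    MemLp (grad φ) 2 (volume.restrict Ω) :=
  (continuous_grad hφ.smooth).memLp_of_hasCompactSupport (hasCompactSupport_grad hφ.compact)

theorem exists_H10_of_isTest {φ : ℝ × ℝ → ℂ} (hφ : IsTest Ω φ) :
    ∃ u : H10 Ω, u.1.fst =ᵐ[volume.restrict Ω] φ ∧ wgrad u =ᵐ[volume.restrict Ω] grad φ := by
  have hfst := (memLp_two_of_isTest hφ).coeFn_toLp
  have hsnd := (memLp_two_grad_of_isTest hφ).coeFn_toLp
  exact ⟨⟨WithLp.toLp 2 (_, _), subset_closure ⟨φ, hφ, hfst, hsnd⟩⟩, hfst, hsnd⟩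

theorem norm_fderiv_le_norm_grad (φ : ℝ × ℝ → ℂ) (x : ℝ × ℝ) :
    ‖fderiv ℝ φ x‖ ≤ 2 * ‖grad φ x‖ := by
  refine ContinuousLinearMap.opNorm_le_bound _ (by positivity) fun v => ?_
  have hv : v = v.1 • ((1 : ℝ), (0 : ℝ)) + v.2 • ((0 : ℝ), (1 : ℝ)) := by simp
  have h0 : ‖fderiv ℝ φ x (1, 0)‖ ≤ ‖grad φ x‖ := PiLp.norm_apply_le (grad φ x) 0
  have h1 : ‖fderiv ℝ φ x (0, 1)‖ ≤ ‖grad φ x‖ := PiLp.norm_apply_le (grad φ x) 1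
  calc ‖fderiv ℝ φ x v‖ = ‖v.1 • fderiv ℝ φ x (1, 0) + v.2 • fderiv ℝ φ x (0, 1)‖ := by
        conv_lhs => rw [hv]
        rw [map_add, map_smul, map_smul]
    _ ≤ ‖v.1‖ * ‖fderiv ℝ φ x (1, 0)‖ + ‖v.2‖ * ‖fderiv ℝ φ x (0, 1)‖ := by
        rw [← norm_smul, ← norm_smul]
        exact norm_add_le _ _
    _ ≤ ‖v‖ * ‖grad φ x‖ + ‖v‖ * ‖grad φ x‖ := by
        gcongr
        exacts [norm_fst_le v, norm_snd_le v]
    _ = 2 * ‖grad φ x‖ * ‖v‖ := by ring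

section Poincare

open scoped ENNReal NNReal

/-- The constant of the Poincaré inequality obtained from the Gagliardo–Nirenberg–Sobolev
inequality `‖φ‖₂ ≤ C ‖∇φ‖₁` in the plane and from Hölder's inequality on `Ω`. -/
def poincareConst (Ω : Set (ℝ × ℝ)) : ℝ≥0∞ :=
  eLpNormLESNormFDerivOneConst (volume : Measure (ℝ × ℝ)) (2 : ℝ≥0) *
    (2 * volume Ω ^ (1 / 2 : ℝ))

theorem poincareConst_ne_top (hΩ : volume Ω ≠ ⊤) : poincareConst Ω ≠ ⊤ :=
  ENNReal.mul_ne_top ENNReal.coe_ne_top <| ENNReal.mul_ne_top ENNReal.ofNat_ne_top <|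
    ENNReal.rpow_ne_top_of_nonneg (by norm_num) hΩ

theorem eLpNorm_le_poincareConst_mul {φ : ℝ × ℝ → ℂ} (hφ : IsTest Ω φ) :
    eLpNorm φ 2 (volume.restrict Ω) ≤
      poincareConst Ω * eLpNorm (grad φ) 2 (volume.restrict Ω) := by
  have hp : NNReal.HolderConjugate (Module.finrank ℝ (ℝ × ℝ)) 2 := by
    rw [NNReal.holderConjugate_iff, Module.finrank_prod, Module.finrank_self]
    norm_num
  have hsupp : Function.support (fderiv ℝ φ) ⊆ Ω :=
    ((subset_tsupport _).trans (tsupport_fderiv_subset ℝ)).trans hφ.support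
  calc eLpNorm φ 2 (volume.restrict Ω) ≤ eLpNorm φ 2 volume := eLpNorm_restrict_le _ _ _ _
    _ ≤ eLpNormLESNormFDerivOneConst (volume : Measure (ℝ × ℝ)) (2 : ℝ≥0) *
          eLpNorm (fderiv ℝ φ) 1 volume :=
        eLpNorm_le_eLpNorm_fderiv_one volume (hφ.smooth.of_le (by simp)) hφ.compact hp
    _ = eLpNormLESNormFDerivOneConst (volume : Measure (ℝ × ℝ)) (2 : ℝ≥0) *
          eLpNorm (fderiv ℝ φ) 1 (volume.restrict Ω) := by
        rw [eLpNorm_restrict_eq_of_support_subset (f := fderiv ℝ φ) (p := 1) hsupp]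
    _ ≤ eLpNormLESNormFDerivOneConst (volume : Measure (ℝ × ℝ)) (2 : ℝ≥0) *
          (2 * eLpNorm (grad φ) 1 (volume.restrict Ω)) := by
        gcongr
        simpa using eLpNorm_le_mul_eLpNorm_of_ae_le_mul (p := 1) (μ := volume.restrict Ω)
          (Eventually.of_forall (norm_fderiv_le_norm_grad φ))
    _ ≤ eLpNormLESNormFDerivOneConst (volume : Measure (ℝ × ℝ)) (2 : ℝ≥0) *
          (2 * (eLpNorm (grad φ) 2 (volume.restrict Ω) * volume Ω ^ (1 / 2 : ℝ))) := by
        gcongr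
        have h := eLpNorm_le_eLpNorm_mul_rpow_measure_univ (μ := volume.restrict Ω)
          one_le_two (continuous_grad hφ.smooth).aestronglyMeasurable
        rw [Measure.restrict_apply_univ] at h
        norm_num at h ⊢
        exact h
    _ = poincareConst Ω * eLpNorm (grad φ) 2 (volume.restrict Ω) := by
        rw [poincareConst]
        ring

theorem norm_fst_le_of_mem_testJets (hΩ : volume Ω ≠ ⊤) {w : Jets Ω} (hw : w ∈ testJets Ω) :
    ‖w.fst‖ ≤ (poincareConst Ω).toReal * ‖w.snd‖ := by
  obtain ⟨φ, hφ, hfst, hsnd⟩ := hw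
  rw [Lp.norm_def, Lp.norm_def, ← ENNReal.toReal_mul, eLpNorm_congr_ae hfst]
  refine ENNReal.toReal_mono
    (ENNReal.mul_ne_top (poincareConst_ne_top hΩ) (Lp.eLpNorm_ne_top _)) ?_
  rw [eLpNorm_congr_ae hsnd]
  exact eLpNorm_le_poincareConst_mul hφ

theorem norm_le_mul_norm_wgrad (hΩ : volume Ω ≠ ⊤) (u : H10 Ω) :
    ‖u‖ ≤ ((poincareConst Ω).toReal + 1) * ‖wgrad u‖ := by
  have hcl : IsClosed {w : Jets Ω | ‖w‖ ≤ ((poincareConst Ω).toReal + 1) * ‖w.snd‖} :=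
    isClosed_le continuous_norm (continuous_const.mul (WithLp.sndL 2 ℂ _ _).continuous.norm)
  refine closure_minimal (fun w hw => ?_) hcl u.2
  have hP := norm_fst_le_of_mem_testJets hΩ hw
  have hC : 0 ≤ (poincareConst Ω).toReal := ENNReal.toReal_nonneg
  refine (sq_le_sq₀ (norm_nonneg w) (by positivity)).1 ?_
  rw [WithLp.prod_norm_sq_eq_of_L2]
  nlinarith [norm_nonneg w.fst, norm_nonneg w.snd, mul_nonneg hC (sq_nonneg ‖w.snd‖)]

end Poincare

theorem exists_H10_of_ae_tendsto (hΩ : volume Ω ≠ ⊤) {u : ℕ → H10 Ω} {f : ℝ × ℝ → ℂ}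
    {G : ℝ × ℝ → EuclideanSpace ℂ (Fin 2)} {M : ℝ}
    (hfM : ∀ n, ∀ᵐ x ∂volume.restrict Ω, ‖(u n).1.fst x‖ ≤ M)
    (hGM : ∀ n, ∀ᵐ x ∂volume.restrict Ω, ‖wgrad (u n) x‖ ≤ M)
    (hf : ∀ᵐ x ∂volume.restrict Ω, Tendsto (fun n => (u n).1.fst x) atTop (𝓝 (f x)))
    (hG : ∀ᵐ x ∂volume.restrict Ω, Tendsto (fun n => wgrad (u n) x) atTop (𝓝 (G x))) :
    ∃ v : H10 Ω, v.1.fst =ᵐ[volume.restrict Ω] f ∧ wgrad v =ᵐ[volume.restrict Ω] G := by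
  have : IsFiniteMeasure ((volume : Measure (ℝ × ℝ)).restrict Ω) :=
    ⟨by rw [Measure.restrict_apply_univ]; exact hΩ.lt_top⟩
  obtain ⟨v, hv, hvlim⟩ := exists_tendsto_Lp_of_ae_tendsto ENNReal.ofNat_ne_top hfM hf
  obtain ⟨V, hV, hVlim⟩ := exists_tendsto_Lp_of_ae_tendsto ENNReal.ofNat_ne_top hGM hG
  have hlim : Tendsto (fun n => (u n).1) atTop (𝓝 (WithLp.toLp 2 (v, V))) :=
    ((WithLp.prod_continuous_toLp 2 _ _).tendsto (v, V)).comp (hvlim.prodMk_nhds hVlim)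
  exact ⟨⟨_, (testJets Ω).isClosed_topologicalClosure.mem_of_tendsto hlim
    (Eventually.of_forall fun n => (u n).2)⟩, hv, hV⟩

theorem integral_mul_grad_eq_neg {φ ψ : ℝ × ℝ → ℂ} (hφ : IsTest Ω φ) (hψ : IsTest Ω ψ)
    (i : Fin 2) :
    ∫ x in Ω, ψ x * grad φ x i = -∫ x in Ω, grad ψ x i * φ x := by
  have hψ0 : ∀ x ∉ Ω, ψ x * grad φ x i = 0 := fun x hx => by
    rw [image_eq_zero_of_notMem_tsupport fun h => hx (hψ.support h), zero_mul]
  have hφ0 : ∀ x ∉ Ω, grad ψ x i * φ x = 0 := fun x hx => by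
    rw [image_eq_zero_of_notMem_tsupport fun h => hx (hφ.support h), mul_zero]
  rw [setIntegral_eq_integral_of_forall_compl_eq_zero hψ0,
    setIntegral_eq_integral_of_forall_compl_eq_zero hφ0]
  have hgrad (χ : ℝ × ℝ → ℂ) (x : ℝ × ℝ) :
      grad χ x i = fderiv ℝ χ x (![((1 : ℝ), (0 : ℝ)), (0, 1)] i) := by fin_cases i <;> rfl
  have hcφ := (PiLp.continuous_apply 2 (fun _ : Fin 2 => ℂ) i).comp (continuous_grad hφ.smooth)
  have hcψ := (PiLp.continuous_apply 2 (fun _ : Fin 2 => ℂ) i).comp (continuous_grad hψ.smooth)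
  have hint₁ := (hcψ.mul hφ.smooth.continuous).integrable_of_hasCompactSupport (μ := volume)
    hφ.compact.mul_left
  have hint₂ := (hψ.smooth.continuous.mul hcφ).integrable_of_hasCompactSupport (μ := volume)
    hψ.compact.mul_right
  simp only [Function.comp_def, hgrad] at hint₁ hint₂ ⊢
  exact integral_mul_fderiv_eq_neg_fderiv_mul_of_integrable hint₁ hint₂
    ((hψ.smooth.continuous.mul hφ.smooth.continuous).integrable_of_hasCompactSupport
      hψ.compact.mul_right)
    (fun x _ => hψ.smooth.differentiable (by simp) x)
    (fun x _ => hφ.smooth.differentiable (by simp) x)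

theorem eq_of_forall_isTest {F G : H10 Ω → ℂ} (hF : Continuous F) (hG : Continuous G)
    (h : ∀ (u : H10 Ω) (φ : ℝ × ℝ → ℂ), IsTest Ω φ → u.1.fst =ᵐ[volume.restrict Ω] φ →
      wgrad u =ᵐ[volume.restrict Ω] grad φ → F u = G u) : F = G := by
  have hdense : Dense {u : H10 Ω | u.1 ∈ testJets Ω} := by
    refine Subtype.dense_iff.2 (closure_mono fun w hw => ?_)
    exact ⟨⟨w, subset_closure hw⟩, hw, rfl⟩
  exact hF.ext_on hdense hG fun u ⟨φ, hφ, hfst, hsnd⟩ => h u φ hφ hfst hsnd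

theorem continuous_integral_mul_Lp {X : Type*} [MeasurableSpace X] {μ : Measure X} {ψ : X → ℂ}
    (hψ : MemLp ψ 2 μ) : Continuous fun w : Lp ℂ 2 μ => ∫ x, ψ x * w x ∂μ := by
  have hinner (w : Lp ℂ 2 μ) : ∫ x, ψ x * w x ∂μ = inner ℂ (hψ.star.toLp _) w := by
    rw [L2.inner_def]
    refine integral_congr_ae ?_
    filter_upwards [hψ.star.coeFn_toLp] with x hx
    rw [hx, RCLike.inner_apply, Pi.star_apply, RCLike.star_def, RCLike.conj_conj, mul_comm]
  simp only [hinner]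
  fun_prop

theorem integral_mul_wgrad_eq_neg (u : H10 Ω) {ψ : ℝ × ℝ → ℂ} (hψ : IsTest Ω ψ) (i : Fin 2) :
    ∫ x in Ω, ψ x * wgrad u x i = -∫ x in Ω, grad ψ x i * u.1.fst x := by
  let P := (EuclideanSpace.proj (𝕜 := ℂ) i).compLpL 2 (volume.restrict Ω)
  have hP (w : Lp (EuclideanSpace ℂ (Fin 2)) 2 (volume.restrict Ω)) :
      ∫ x in Ω, ψ x * P w x = ∫ x in Ω, ψ x * w x i := by
    refine integral_congr_ae ?_
    filter_upwards [ContinuousLinearMap.coeFn_compLpL (EuclideanSpace.proj (𝕜 := ℂ) i) w]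
      with x hx
    rw [hx]
    rfl
  have hcl : IsClosed {w : Jets Ω |
      ∫ x in Ω, ψ x * P w.snd x = -∫ x in Ω, grad ψ x i * w.fst x} :=
    isClosed_eq
      ((continuous_integral_mul_Lp (memLp_two_of_isTest hψ)).comp
        (P.continuous.comp (WithLp.sndL 2 ℂ _ _).continuous))
      ((continuous_integral_mul_Lp ((memLp_two_grad_of_isTest hψ).eval_piLp i)).comp
        (WithLp.fstL 2 ℂ _ _).continuous).neg
  rw [← hP]
  refine closure_minimal (fun w hw => ?_) hcl u.2
  obtain ⟨φ, hφ, hfst, hsnd⟩ := hw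
  calc ∫ x in Ω, ψ x * P w.snd x = ∫ x in Ω, ψ x * grad φ x i := by
        rw [hP]
        refine integral_congr_ae ?_
        filter_upwards [hsnd] with x hx using by rw [hx]
    _ = -∫ x in Ω, grad ψ x i * φ x := integral_mul_grad_eq_neg hφ hψ i
    _ = -∫ x in Ω, grad ψ x i * w.fst x := by
        refine congrArg Neg.neg (integral_congr_ae ?_)
        filter_upwards [hfst] with x hx using by rw [hx]

theorem isTest_ofReal {g : ℝ × ℝ → ℝ} (hg : ContDiff ℝ ∞ g) (hc : HasCompactSupport g)
    (hs : tsupport g ⊆ Ω) : IsTest Ω fun x => (g x : ℂ) where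
  smooth := Complex.ofRealCLM.contDiff.comp hg
  compact := hc.comp_left Complex.ofReal_zero
  support := (closure_mono (Function.support_comp_subset Complex.ofReal_zero g)).trans hs

theorem eq_zero_of_fst_ae_eq_zero (hΩ : IsOpen Ω) {u : H10 Ω}
    (hu : u.1.fst =ᵐ[volume.restrict Ω] 0) : u = 0 := by
  have hgrad (i : Fin 2) : ∀ᵐ x, x ∈ Ω → wgrad u x i = 0 := by
    refine hΩ.ae_eq_zero_of_integral_contDiff_smul_eq_zero ?_ fun g hg hc hs => ?_
    · exact locallyIntegrableOn_of_locallyIntegrable_restrict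
        (((Lp.memLp (wgrad u)).eval_piLp i).locallyIntegrable one_le_two)
    · have hψ := isTest_ofReal hg hc hs
      have hg0 : ∀ x ∉ Ω, g x • wgrad u x i = 0 := fun x hx => by
        rw [image_eq_zero_of_notMem_tsupport fun h => hx (hs h), zero_smul]
      rw [← setIntegral_eq_integral_of_forall_compl_eq_zero hg0]
      simp only [Complex.real_smul]
      rw [integral_mul_wgrad_eq_neg u hψ i, integral_eq_zero_of_ae, neg_zero]
      filter_upwards [hu] with x hx
      simp [hx]
  have hsnd : wgrad u =ᵐ[volume.restrict Ω] 0 := by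
    filter_upwards [(ae_restrict_iff' hΩ.measurableSet).2 (hgrad 0),
      (ae_restrict_iff' hΩ.measurableSet).2 (hgrad 1)] with x h0 h1
    ext i
    fin_cases i
    exacts [h0, h1]
  refine Subtype.ext (WithLp.ofLp_injective 2 (Prod.ext ?_ ?_))
  exacts [(Lp.eq_zero_iff_ae_eq_zero).2 hu, (Lp.eq_zero_iff_ae_eq_zero).2 hsnd]

/-! ### Logarithmic polar coordinates -/

/-- Logarithmic polar coordinates `(s, θ) ↦ (eˢ cos θ, eˢ sin θ)`. -/
def logPolar (p : ℝ × ℝ) : ℝ × ℝ :=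
  (Real.exp p.1 * Real.cos p.2, Real.exp p.1 * Real.sin p.2)

/-- The inverse of `logPolar`, given by the principal branch of the complex logarithm. -/
def logPolarInv (x : ℝ × ℝ) : ℝ × ℝ :=
  ((Complex.log (Complex.equivRealProdCLM.symm x)).re,
    (Complex.log (Complex.equivRealProdCLM.symm x)).im)

/-- The rectangle of logarithmic polar coordinates of the half-annulus. -/
def rect (δ : ℝ) : Set (ℝ × ℝ) := Ioo (Real.log δ) 0 ×ˢ Ioo 0 Real.pi

theorem isOpen_rect (δ : ℝ) : IsOpen (rect δ) := isOpen_Ioo.prod isOpen_Ioo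

theorem measurableSet_rect (δ : ℝ) : MeasurableSet (rect δ) := (isOpen_rect δ).measurableSet

theorem exp_neg_fst_le_inv {δ : ℝ} (hδ : 0 < δ) {p : ℝ × ℝ} (hp : p ∈ rect δ) :
    Real.exp (-p.1) ≤ δ⁻¹ := by
  rw [← Real.exp_log (inv_pos.2 hδ), Real.log_inv]
  exact Real.exp_le_exp.2 (neg_le_neg hp.1.1.le)

theorem contDiff_logPolar : ContDiff ℝ ∞ logPolar := by
  unfold logPolar
  fun_prop

theorem equivRealProdCLM_symm_logPolar (p : ℝ × ℝ) :
    Complex.equivRealProdCLM.symm (logPolar p) = Complex.exp (p.1 + p.2 * Complex.I) := by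
  apply Complex.ext
  · simp [logPolar, Complex.exp_re]
  · simp [logPolar, Complex.exp_im]

theorem logPolarInv_logPolar {p : ℝ × ℝ} (h₁ : -Real.pi < p.2) (h₂ : p.2 ≤ Real.pi) :
    logPolarInv (logPolar p) = p := by
  rw [logPolarInv, equivRealProdCLM_symm_logPolar, Complex.log_exp (by simpa) (by simpa)]
  ext <;> simp

theorem logPolar_logPolarInv {x : ℝ × ℝ} (hx : x ≠ 0) : logPolar (logPolarInv x) = x := by
  apply Complex.equivRealProdCLM.symm.injective
  rw [equivRealProdCLM_symm_logPolar, logPolarInv, Complex.re_add_im, Complex.exp_log]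
  simpa using hx

theorem logPolarInv_logPolar_of_mem {δ : ℝ} {p : ℝ × ℝ} (hp : p ∈ rect δ) :
    logPolarInv (logPolar p) = p :=
  logPolarInv_logPolar (by linarith [hp.2.1, Real.pi_pos]) hp.2.2.le

theorem injOn_logPolar (δ : ℝ) : InjOn logPolar (rect δ) :=
  LeftInvOn.injOn fun _ => logPolarInv_logPolar_of_mem

theorem logPolar_mem_sector {δ α β : ℝ} (hδ : 0 < δ) (hα : 0 ≤ α) (hβ : β ≤ Real.pi) {p : ℝ × ℝ}
    (hp : p ∈ rect δ) : logPolar p ∈ sector δ α β ↔ p.2 ∈ Ioo α β := by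
  have hpi := Real.pi_pos
  constructor
  · rintro ⟨⟨r, θ⟩, ⟨hr, hθ⟩, h⟩
    have hr0 : 0 < r := hδ.trans hr.1
    have h' : logPolar (Real.log r, θ) = logPolar p := by
      rw [← h, logPolar, Real.exp_log hr0]
    have hθ' : θ ∈ Ioo α β := hθ
    have : p = (Real.log r, θ) := by
      rw [← logPolarInv_logPolar_of_mem hp, ← h',
        logPolarInv_logPolar (by simp only; linarith [hθ'.1]) (hθ'.2.le.trans hβ)]
    rw [this]
    exact hθ'
  · intro h
    refine ⟨(Real.exp p.1, p.2), ⟨⟨?_, ?_⟩, h⟩, rfl⟩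
    · exact (Real.log_lt_iff_lt_exp hδ).1 hp.1.1
    · exact Real.exp_lt_one_iff.2 hp.1.2

theorem image_logPolar {δ : ℝ} (hδ : 0 < δ) : logPolar '' rect δ = dom δ := by
  apply Subset.antisymm
  · rintro _ ⟨p, hp, rfl⟩
    exact (logPolar_mem_sector hδ le_rfl le_rfl hp).2 hp.2
  · rintro _ ⟨⟨r, θ⟩, ⟨hr, hθ⟩, rfl⟩
    have hr0 : 0 < r := hδ.trans hr.1
    refine ⟨(Real.log r, θ), ⟨⟨Real.log_lt_log hδ hr.1, Real.log_neg hr0 hr.2⟩, hθ⟩, ?_⟩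
    rw [logPolar, Real.exp_log hr0]

theorem logPolarInv_mem_rect {δ : ℝ} (hδ : 0 < δ) {x : ℝ × ℝ} (hx : x ∈ dom δ) :
    logPolarInv x ∈ rect δ := by
  rw [← image_logPolar hδ] at hx
  obtain ⟨p, hp, rfl⟩ := hx
  rwa [logPolarInv_logPolar_of_mem hp]

theorem snd_pos_of_mem_dom {δ : ℝ} (hδ : 0 < δ) {x : ℝ × ℝ} (hx : x ∈ dom δ) : 0 < x.2 := by
  obtain ⟨⟨r, θ⟩, ⟨hr, hθ⟩, rfl⟩ := hx
  exact mul_pos (hδ.trans hr.1) (Real.sin_pos_of_pos_of_lt_pi hθ.1 hθ.2)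

theorem contDiffAt_logPolarInv {x : ℝ × ℝ} (hx : 0 < x.2) : ContDiffAt ℝ ∞ logPolarInv x := by
  have h : ContDiffAt ℝ ∞ (fun x : ℝ × ℝ => Complex.log (Complex.equivRealProdCLM.symm x)) x := by
    have h1 : Complex.equivRealProdCLM.symm x ∈ Complex.slitPlane :=
      Or.inr (by simpa using hx.ne')
    have h2 : ContDiffAt ℝ ∞ Complex.log (Complex.equivRealProdCLM.symm x) :=
      (Complex.contDiffAt_log h1).restrict_scalars ℝ
    exact h2.comp x Complex.equivRealProdCLM.symm.contDiff.contDiffAt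
  exact (Complex.reCLM.contDiff.contDiffAt.comp x h).prodMk
    (Complex.imCLM.contDiff.contDiffAt.comp x h)

theorem isOpen_dom {δ : ℝ} (hδ : 0 < δ) : IsOpen (dom δ) := by
  have : dom δ = {x | 0 < x.2} ∩ logPolarInv ⁻¹' (rect δ) := by
    ext x
    refine ⟨fun hx => ⟨snd_pos_of_mem_dom hδ hx, logPolarInv_mem_rect hδ hx⟩, fun hx => ?_⟩
    rw [← image_logPolar hδ]
    refine ⟨_, hx.2, logPolar_logPolarInv ?_⟩
    rintro rfl
    exact lt_irrefl (0 : ℝ) hx.1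
  rw [this]
  refine ContinuousOn.isOpen_inter_preimage ?_ (isOpen_lt continuous_const continuous_snd)
    (isOpen_rect δ)
  exact fun x hx => (contDiffAt_logPolarInv hx).continuousAt.continuousWithinAt

theorem measurableSet_dom (δ : ℝ) : MeasurableSet (dom δ) := measurableSet_sector _ _ _

theorem volume_dom_lt_top {δ : ℝ} (hδ : 0 < δ) : volume (dom δ) < ⊤ := by
  have : dom δ ⊆ Icc (-1) 1 ×ˢ Icc (-1) 1 := by
    rintro _ ⟨⟨r, θ⟩, ⟨hr, -⟩, rfl⟩
    have h0 : 0 < r := hδ.trans hr.1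
    have h1 : r < 1 := hr.2
    have := Real.neg_one_le_cos θ
    have := Real.cos_le_one θ
    have := Real.neg_one_le_sin θ
    have := Real.sin_le_one θ
    refine ⟨⟨?_, ?_⟩, ⟨?_, ?_⟩⟩ <;> simp only <;> nlinarith
  exact (measure_mono this).trans_lt (isCompact_Icc.prod isCompact_Icc).measure_lt_top

/-- The derivative of `logPolar`. -/
def logPolarDeriv (p : ℝ × ℝ) : ℝ × ℝ →L[ℝ] ℝ × ℝ :=
  LinearMap.toContinuousLinearMap (Matrix.toLin (.finTwoProd ℝ) (.finTwoProd ℝ)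
    !![Real.exp p.1 * Real.cos p.2, -(Real.exp p.1 * Real.sin p.2);
      Real.exp p.1 * Real.sin p.2, Real.exp p.1 * Real.cos p.2])

theorem logPolarDeriv_apply (p v : ℝ × ℝ) : logPolarDeriv p v =
    (Real.exp p.1 * Real.cos p.2 * v.1 - Real.exp p.1 * Real.sin p.2 * v.2,
      Real.exp p.1 * Real.sin p.2 * v.1 + Real.exp p.1 * Real.cos p.2 * v.2) := by
  rw [logPolarDeriv, LinearMap.coe_toContinuousLinearMap', Matrix.toLin_finTwoProd_apply]
  ext
  · simp
    ring
  · simp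

theorem hasFDerivAt_logPolar (p : ℝ × ℝ) : HasFDerivAt logPolar (logPolarDeriv p) p := by
  have h1 : HasFDerivAt (fun p : ℝ × ℝ => Real.exp p.1)
      (Real.exp p.1 • ContinuousLinearMap.fst ℝ ℝ ℝ) p := hasFDerivAt_fst.exp
  have h2 : HasFDerivAt (fun p : ℝ × ℝ => Real.cos p.2)
      (-Real.sin p.2 • ContinuousLinearMap.snd ℝ ℝ ℝ) p := hasFDerivAt_snd.cos
  have h3 : HasFDerivAt (fun p : ℝ × ℝ => Real.sin p.2)
      (Real.cos p.2 • ContinuousLinearMap.snd ℝ ℝ ℝ) p := hasFDerivAt_snd.sin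
  refine ((h1.mul h2).prodMk (h1.mul h3)).congr_fderiv ?_
  ext <;> simp [logPolarDeriv_apply, mul_comm]

theorem det_logPolarDeriv (p : ℝ × ℝ) : (logPolarDeriv p).det = Real.exp p.1 ^ 2 := by
  rw [logPolarDeriv, LinearMap.det_toContinuousLinearMap, LinearMap.det_toLin,
    Matrix.det_fin_two_of]
  linear_combination Real.exp p.1 ^ 2 * Real.sin_sq_add_cos_sq p.2

theorem integral_dom {E : Type*} [NormedAddCommGroup E] [NormedSpace ℝ E] {δ : ℝ} (hδ : 0 < δ)
    (F : ℝ × ℝ → E) :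
    ∫ x in dom δ, F x = ∫ p in rect δ, Real.exp p.1 ^ 2 • F (logPolar p) := by
  rw [← image_logPolar hδ, integral_image_eq_integral_abs_det_fderiv_smul volume
    (measurableSet_rect δ) (fun p _ => (hasFDerivAt_logPolar p).hasFDerivWithinAt)
    (injOn_logPolar δ)]
  refine integral_congr_ae (Eventually.of_forall fun p => ?_)
  simp only
  rw [det_logPolarDeriv, abs_of_nonneg (by positivity)]

theorem ae_restrict_image_of_differentiableOn {f : ℝ × ℝ → ℝ × ℝ} {s : Set (ℝ × ℝ)}
    {P : ℝ × ℝ → Prop} (hs : MeasurableSet s) (hfs : MeasurableSet (f '' s))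
    (hf : DifferentiableOn ℝ f s) (h : ∀ᵐ p ∂volume.restrict s, P (f p)) :
    ∀ᵐ x ∂volume.restrict (f '' s), P x := by
  rw [ae_restrict_iff' hs] at h
  rw [ae_restrict_iff' hfs]
  have hnull : volume (s ∩ {p | ¬ P (f p)}) = 0 := by
    refine measure_mono_null ?_ (ae_iff.1 h)
    exact fun p hp H => hp.2 (H hp.1)
  refine measure_mono_null ?_ <| addHaar_image_eq_zero_of_differentiableOn_of_addHaar_eq_zero
    volume (hf.mono inter_subset_left) hnull
  intro x hx
  obtain ⟨⟨p, hp, rfl⟩, hPp⟩ := Classical.not_imp.1 hx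
  exact ⟨p, ⟨hp, hPp⟩, rfl⟩

theorem ae_restrict_dom_iff {δ : ℝ} (hδ : 0 < δ) {P : ℝ × ℝ → Prop} :
    (∀ᵐ x ∂volume.restrict (dom δ), P x) ↔ ∀ᵐ p ∂volume.restrict (rect δ), P (logPolar p) := by
  have himage : logPolarInv '' dom δ = rect δ := by
    rw [← image_logPolar hδ, image_image, image_congr (g := id), image_id]
    exact fun p hp => logPolarInv_logPolar_of_mem hp
  constructor <;> intro h
  · rw [← himage]
    refine ae_restrict_image_of_differentiableOn (measurableSet_dom δ)
      (himage ▸ measurableSet_rect δ) (fun x hx => ?_) ?_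
    · exact ((contDiffAt_logPolarInv (snd_pos_of_mem_dom hδ hx)).differentiableAt
        (by simp)).differentiableWithinAt
    · filter_upwards [h, ae_restrict_mem (measurableSet_dom δ)] with x hx hmem
      rwa [logPolar_logPolarInv]
      rintro rfl
      exact lt_irrefl _ (snd_pos_of_mem_dom hδ hmem)
  · rw [← image_logPolar hδ]
    exact ae_restrict_image_of_differentiableOn (measurableSet_rect δ)
      (image_logPolar hδ ▸ measurableSet_dom δ)
      (fun p _ => (hasFDerivAt_logPolar p).differentiableAt.differentiableWithinAt) h

theorem coeff_logPolar {δ : ℝ} (hδ : 0 < δ) (σp σm : ℝ) {p : ℝ × ℝ} (hp : p ∈ rect δ)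
    (h : p.2 ≠ Real.pi / 4) :
    coeff δ σp σm (logPolar p) = if p.2 < Real.pi / 4 then σm else σp := by
  have hpi := Real.pi_pos
  have h1 := logPolar_mem_sector (α := Real.pi / 4) (β := Real.pi) hδ (by positivity) le_rfl hp
  have h2 := logPolar_mem_sector (α := 0) (β := Real.pi / 4) hδ le_rfl (by linarith) hp
  rw [coeff, domPos, domNeg]
  split_ifs with hlt
  · rw [indicator_of_notMem (by rw [h1]; exact fun h => absurd h.1 (by linarith)),
      indicator_of_mem (h2.2 ⟨hp.2.1, hlt⟩), zero_add]
  · have hgt := lt_of_le_of_ne (not_lt.1 hlt) h.symm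
    rw [indicator_of_mem (h1.2 ⟨hgt, hp.2.2⟩),
      indicator_of_notMem (by rw [h2]; exact fun h => absurd h.2 (by linarith)), add_zero]

/-- `e^ρ` times the components of the vector `g` in the orthonormal frame `(e_r, e_θ)` at the
point with logarithmic polar coordinates `p = (ρ, θ)`; this turns a gradient in Cartesian
coordinates into one in logarithmic polar coordinates. -/
def polarFrame (p : ℝ × ℝ) (g : EuclideanSpace ℂ (Fin 2)) : EuclideanSpace ℂ (Fin 2) :=
  !₂[Real.exp p.1 * (Real.cos p.2 * g 0 + Real.sin p.2 * g 1),
    Real.exp p.1 * (-Real.sin p.2 * g 0 + Real.cos p.2 * g 1)]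

theorem continuous_polarFrame (p : ℝ × ℝ) : Continuous (polarFrame p) := by
  refine (PiLp.continuous_toLp 2 _).comp (continuous_pi fun i => ?_)
  fin_cases i
  · simp only [Fin.zero_eta, Matrix.cons_val_zero]
    fun_prop
  · simp only [Fin.mk_one, Matrix.cons_val_one]
    fun_prop

theorem polarFrame_neg_polarFrame (p : ℝ × ℝ) (g : EuclideanSpace ℂ (Fin 2)) :
    polarFrame (-p) (polarFrame p g) = g := by
  have hexp : (Real.exp (-p.1) : ℂ) * Real.exp p.1 = 1 := by
    rw [← Complex.ofReal_mul, ← Real.exp_add, neg_add_cancel, Real.exp_zero, Complex.ofReal_one]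
  have htrig : (Real.sin p.2 : ℂ) ^ 2 + (Real.cos p.2 : ℂ) ^ 2 = 1 := by
    exact_mod_cast Real.sin_sq_add_cos_sq p.2
  ext i
  fin_cases i
  · simp only [polarFrame, Prod.fst_neg, Prod.snd_neg, Real.cos_neg, Real.sin_neg, PiLp.toLp_apply,
      Fin.zero_eta, Matrix.cons_val_zero, Matrix.cons_val_one, Complex.ofReal_neg]
    linear_combination (g 0) * htrig + (g 0) * (Real.sin p.2 ^ 2 + Real.cos p.2 ^ 2) * hexp
  · simp only [polarFrame, Prod.fst_neg, Prod.snd_neg, Real.cos_neg, Real.sin_neg, PiLp.toLp_apply,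
      Fin.mk_one, Matrix.cons_val_zero, Matrix.cons_val_one, Complex.ofReal_neg]
    linear_combination (g 1) * htrig + (g 1) * (Real.sin p.2 ^ 2 + Real.cos p.2 ^ 2) * hexp

theorem inner_polarFrame (p : ℝ × ℝ) (g h : EuclideanSpace ℂ (Fin 2)) :
    inner ℂ (polarFrame p g) (polarFrame p h) = (Real.exp p.1 : ℂ) ^ 2 * inner ℂ g h := by
  have htrig : (Real.sin p.2 : ℂ) ^ 2 + (Real.cos p.2 : ℂ) ^ 2 = 1 := by
    exact_mod_cast Real.sin_sq_add_cos_sq p.2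
  simp only [PiLp.inner_apply, Fin.sum_univ_two, RCLike.inner_apply, polarFrame,
    Matrix.cons_val_zero, Matrix.cons_val_one, map_mul, map_add, map_neg, Complex.conj_ofReal]
  linear_combination (Real.exp p.1 : ℂ) ^ 2 *
    (h 0 * starRingEnd ℂ (g 0) + h 1 * starRingEnd ℂ (g 1)) * htrig

theorem norm_polarFrame (p : ℝ × ℝ) (g : EuclideanSpace ℂ (Fin 2)) :
    ‖polarFrame p g‖ = Real.exp p.1 * ‖g‖ := by
  have h := inner_polarFrame p g g
  simp only [inner_self_eq_norm_sq_to_K] at h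
  refine (pow_left_inj₀ (norm_nonneg _) (by positivity) two_ne_zero).1 ?_
  rw [mul_pow]
  refine Complex.ofReal_injective ?_
  rw [Complex.ofReal_mul, Complex.ofReal_pow, Complex.ofReal_pow, Complex.ofReal_pow]
  exact h

theorem grad_comp_logPolar {φ : ℝ × ℝ → ℂ} {p : ℝ × ℝ}
    (hφ : DifferentiableAt ℝ φ (logPolar p)) :
    grad (φ ∘ logPolar) p = polarFrame p (grad φ (logPolar p)) := by
  have hlin (a b : ℝ) : fderiv ℝ φ (logPolar p) (a, b) =
      a * fderiv ℝ φ (logPolar p) (1, 0) + b * fderiv ℝ φ (logPolar p) (0, 1) := by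
    have hab : ((a, b) : ℝ × ℝ) = a • (1, 0) + b • (0, 1) := by simp
    rw [hab, map_add, map_smul, map_smul, Complex.real_smul, Complex.real_smul]
  rw [grad, (hφ.hasFDerivAt.comp p (hasFDerivAt_logPolar p)).fderiv]
  simp only [ContinuousLinearMap.comp_apply, logPolarDeriv_apply, mul_one, mul_zero, sub_zero,
    add_zero, zero_sub, zero_add]
  rw [hlin (Real.exp p.1 * Real.cos p.2), hlin (-(Real.exp p.1 * Real.sin p.2))]
  ext i
  fin_cases i <;> simp [polarFrame, grad] <;> ring

/-- The gradient of an element of `H¹₀(Ω^δ)` in logarithmic polar coordinates. -/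
def polarGrad {δ : ℝ} (u : H10 (dom δ)) (p : ℝ × ℝ) : EuclideanSpace ℂ (Fin 2) :=
  polarFrame p (wgrad u (logPolar p))

theorem ae_snd_ne (c : ℝ) : ∀ᵐ p : ℝ × ℝ, p.2 ≠ c :=
  Measure.quasiMeasurePreserving_snd.ae (Measure.ae_ne volume c)

theorem A_apply_eq_integral_polarGrad {δ : ℝ} (hδ : 0 < δ) (σp σm : ℝ) (u v : H10 (dom δ)) :
    A δ σp σm u v = ∫ p in rect δ, ((if p.2 < Real.pi / 4 then σm else σp : ℝ) : ℂ) *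
      inner ℂ (polarGrad v p) (polarGrad u p) := by
  rw [A_apply, integral_dom hδ]
  refine integral_congr_ae ?_
  filter_upwards [ae_restrict_mem (measurableSet_rect δ),
    ae_restrict_of_ae (ae_snd_ne (Real.pi / 4))] with p hp hp'
  rw [coeff_logPolar hδ σp σm hp hp', polarGrad, polarGrad, inner_polarFrame, Complex.real_smul]
  push_cast
  ring

/-- `f`, a function of logarithmic polar coordinates, represents `u ∈ H¹₀(Ω^δ)` together with its
weak gradient. Where `f` is not differentiable `grad f` is a junk value; for Lipschitz `f` this
happens only on a null set. -/
def IsPolarRep {δ : ℝ} (u : H10 (dom δ)) (f : ℝ × ℝ → ℂ) : Prop :=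
  ∀ᵐ p ∂volume.restrict (rect δ), u.1.fst (logPolar p) = f p ∧ polarGrad u p = grad f p

theorem IsPolarRep.congr {δ : ℝ} {u : H10 (dom δ)} {f g : ℝ × ℝ → ℂ} (h : IsPolarRep u f)
    (hfg : EqOn f g (rect δ)) : IsPolarRep u g := by
  filter_upwards [h, ae_restrict_mem (measurableSet_rect δ)] with p hp hmem
  have heq : f =ᶠ[𝓝 p] g := hfg.eventuallyEq_of_mem ((isOpen_rect δ).mem_nhds hmem)
  exact ⟨hp.1.trans heq.eq_of_nhds, hp.2.trans (by rw [grad, grad, heq.fderiv_eq])⟩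

theorem isPolarRep_comp_logPolar {δ : ℝ} (hδ : 0 < δ) {φ : ℝ × ℝ → ℂ} (hφ : Differentiable ℝ φ)
    {u : H10 (dom δ)} (hu : u.1.fst =ᵐ[volume.restrict (dom δ)] φ)
    (hgrad : wgrad u =ᵐ[volume.restrict (dom δ)] grad φ) : IsPolarRep u (φ ∘ logPolar) := by
  filter_upwards [(ae_restrict_dom_iff hδ).1 hu, (ae_restrict_dom_iff hδ).1 hgrad] with p hp hgp
  exact ⟨hp, by rw [polarGrad, hgp, grad_comp_logPolar (hφ _)]⟩

theorem isTest_comp_logPolarInv {δ : ℝ} (hδ : 0 < δ) {ψ : ℝ × ℝ → ℂ} (hψ : IsTest (rect δ) ψ) :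
    IsTest (dom δ) (ψ ∘ logPolarInv) := by
  have hK : IsCompact (logPolar '' tsupport ψ) :=
    hψ.compact.isCompact.image contDiff_logPolar.continuous
  have h0 : logPolarInv 0 = 0 := by simp [logPolarInv]
  have hsub : Function.support (ψ ∘ logPolarInv) ⊆ logPolar '' tsupport ψ := by
    intro x hx
    have hx' : logPolarInv x ∈ tsupport ψ := subset_tsupport _ hx
    refine ⟨_, hx', logPolar_logPolarInv ?_⟩
    rintro rfl
    rw [h0] at hx'
    exact lt_irrefl (0 : ℝ) (hψ.support hx').1.2
  have hts : tsupport (ψ ∘ logPolarInv) ⊆ logPolar '' tsupport ψ :=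
    closure_minimal hsub hK.isClosed
  have hd : tsupport (ψ ∘ logPolarInv) ⊆ dom δ := by
    rw [← image_logPolar hδ]
    exact hts.trans (image_mono hψ.support)
  refine ⟨contDiff_iff_contDiffAt.2 fun x => ?_,
    HasCompactSupport.of_support_subset_isCompact hK hsub, hd⟩
  by_cases hx : x ∈ tsupport (ψ ∘ logPolarInv)
  · exact hψ.smooth.contDiffAt.comp x (contDiffAt_logPolarInv (snd_pos_of_mem_dom hδ (hd hx)))
  · exact contDiffAt_const.congr_of_eventuallyEq (notMem_tsupport_iff_eventuallyEq.1 hx)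

theorem exists_isPolarRep_of_isTest {δ : ℝ} (hδ : 0 < δ) {ψ : ℝ × ℝ → ℂ}
    (hψ : IsTest (rect δ) ψ) : ∃ u : H10 (dom δ), IsPolarRep u ψ := by
  have hφ := isTest_comp_logPolarInv hδ hψ
  obtain ⟨u, hu, hgrad⟩ := exists_H10_of_isTest hφ
  refine ⟨u, (isPolarRep_comp_logPolar hδ (hφ.smooth.differentiable (by simp)) hu hgrad).congr
    fun p hp => ?_⟩
  rw [Function.comp_apply, Function.comp_apply, logPolarInv_logPolar_of_mem hp]

theorem norm_grad_le (φ : ℝ × ℝ → ℂ) (p : ℝ × ℝ) : ‖grad φ p‖ ≤ 2 * ‖fderiv ℝ φ p‖ := by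
  have hfst : ‖fderiv ℝ φ p (1, 0)‖ ≤ ‖fderiv ℝ φ p‖ :=
    (fderiv ℝ φ p).le_of_opNorm_le_of_le le_rfl (by simp [Prod.norm_def]) |>.trans_eq (mul_one _)
  have hsnd : ‖fderiv ℝ φ p (0, 1)‖ ≤ ‖fderiv ℝ φ p‖ :=
    (fderiv ℝ φ p).le_of_opNorm_le_of_le le_rfl (by simp [Prod.norm_def]) |>.trans_eq (mul_one _)
  rw [EuclideanSpace.norm_eq, Fin.sum_univ_two, Real.sqrt_le_left (by positivity)]
  change ‖fderiv ℝ φ p (1, 0)‖ ^ 2 + ‖fderiv ℝ φ p (0, 1)‖ ^ 2 ≤ _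
  nlinarith [norm_nonneg (fderiv ℝ φ p (1, 0)), norm_nonneg (fderiv ℝ φ p (0, 1))]

theorem grad_ofReal {f : ℝ × ℝ → ℝ} {p : ℝ × ℝ} (hf : DifferentiableAt ℝ f p) :
    grad (fun q => (f q : ℂ)) p =
      !₂[(fderiv ℝ f p (1, 0) : ℂ), (fderiv ℝ f p (0, 1) : ℂ)] := by
  have h : HasFDerivAt (fun q => (f q : ℂ)) (Complex.ofRealCLM.comp (fderiv ℝ f p)) p :=
    Complex.ofRealCLM.hasFDerivAt.comp p hf.hasFDerivAt
  rw [grad, h.fderiv]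
  rfl

section Lipschitz

variable {δ : ℝ} {K : ℝ≥0} {V : ℕ → ℝ × ℝ → ℝ} {W : ℝ × ℝ → ℝ}

theorem ae_tendsto_grad_ofReal (hV : TendstoLipschitz volume K V W) (hW : LipschitzWith K W) :
    ∀ᵐ p, Tendsto (fun n => grad (fun q => (V n q : ℂ)) p) atTop
      (𝓝 (grad (fun q => (W q : ℂ)) p)) := by
  filter_upwards [hV.ae_tendsto_fderiv, hW.ae_differentiableAt (μ := volume),
    ae_all_iff.2 fun n => (hV.lipschitz n).ae_differentiableAt (μ := volume)] with p hp hWp hVp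
  have hcont : Continuous fun L : ℝ × ℝ →L[ℝ] ℝ => !₂[(L (1, 0) : ℂ), (L (0, 1) : ℂ)] := by
    refine (PiLp.continuous_toLp 2 _).comp (continuous_pi fun i => ?_)
    fin_cases i
    · exact Complex.continuous_ofReal.comp (continuous_eval_const _)
    · exact Complex.continuous_ofReal.comp (continuous_eval_const _)
  rw [grad_ofReal hWp]
  simp only [grad_ofReal (hVp _)]
  exact (hcont.tendsto _).comp hp

theorem norm_polarFrame_neg_grad_le (hδ : 0 < δ) (hW : LipschitzWith K W) {p : ℝ × ℝ}
    (hp : p ∈ rect δ) : ‖polarFrame (-p) (grad (fun q => (W q : ℂ)) p)‖ ≤ δ⁻¹ * (2 * K) := by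
  have hlip : LipschitzWith K fun q => (W q : ℂ) := by
    rw [← one_mul K]
    exact Complex.isometry_ofReal.lipschitz.comp hW
  have hexp : Real.exp (-p).1 ≤ δ⁻¹ := exp_neg_fst_le_inv hδ hp
  rw [norm_polarFrame]
  gcongr
  exact (norm_grad_le _ p).trans
    (mul_le_mul_of_nonneg_left (norm_fderiv_le_of_lipschitz ℝ hlip) two_pos.le)

theorem exists_isPolarRep_of_tendstoLipschitz (hδ : 0 < δ) (hV : TendstoLipschitz volume K V W)
    (hW : LipschitzWith K W) (hrep : ∀ n, ∃ u : H10 (dom δ), IsPolarRep u fun p => (V n p : ℂ)) :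
    ∃ u : H10 (dom δ), IsPolarRep u fun p => (W p : ℂ) := by
  choose u hu using hrep
  obtain ⟨C, hC⟩ := hV.bounded
  have hwgrad (v : H10 (dom δ)) (p : ℝ × ℝ) :
      wgrad v (logPolar p) = polarFrame (-p) (polarGrad v p) :=
    (polarFrame_neg_polarFrame p _).symm
  suffices h : ∃ v : H10 (dom δ),
      (v.1.fst =ᵐ[volume.restrict (dom δ)] fun x => (W (logPolarInv x) : ℂ)) ∧
      wgrad v =ᵐ[volume.restrict (dom δ)]
        fun x => polarFrame (-logPolarInv x) (grad (fun q => (W q : ℂ)) (logPolarInv x)) by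
    obtain ⟨v, hv, hvgrad⟩ := h
    refine ⟨v, ?_⟩
    filter_upwards [(ae_restrict_dom_iff hδ).1 hv, (ae_restrict_dom_iff hδ).1 hvgrad,
      ae_restrict_mem (measurableSet_rect δ)] with p hp hgp hmem
    rw [logPolarInv_logPolar_of_mem hmem] at hp hgp
    refine ⟨hp, ?_⟩
    rw [polarGrad, hgp]
    simpa only [neg_neg] using polarFrame_neg_polarFrame (-p) (grad (fun q => (W q : ℂ)) p)
  refine exists_H10_of_ae_tendsto (u := u) (M := max C (δ⁻¹ * (2 * K)))
    (volume_dom_lt_top hδ).ne (fun n => (ae_restrict_dom_iff hδ).2 ?_)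
    (fun n => (ae_restrict_dom_iff hδ).2 ?_) ((ae_restrict_dom_iff hδ).2 ?_)
    ((ae_restrict_dom_iff hδ).2 ?_)
  · filter_upwards [hu n] with p hp
    rw [hp.1, Complex.norm_real]
    exact (hC n p).trans (le_max_left _ _)
  · filter_upwards [hu n, ae_restrict_mem (measurableSet_rect δ)] with p hp hmem
    rw [hwgrad, hp.2]
    exact (norm_polarFrame_neg_grad_le hδ (hV.lipschitz n) hmem).trans (le_max_right _ _)
  · filter_upwards [ae_all_iff.2 hu, ae_restrict_mem (measurableSet_rect δ)] with p hp hmem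
    simp only [(hp _).1, logPolarInv_logPolar_of_mem hmem]
    exact (Complex.continuous_ofReal.tendsto _).comp (hV.tendsto p)
  · filter_upwards [ae_all_iff.2 hu, ae_restrict_mem (measurableSet_rect δ),
      ae_restrict_of_ae (ae_tendsto_grad_ofReal hV hW)] with p hp hmem hlim
    simp only [hwgrad, (hp _).2, logPolarInv_logPolar_of_mem hmem]
    exact ((continuous_polarFrame (-p)).tendsto _).comp hlim

theorem exists_isPolarRep_of_lipschitz (hδ : 0 < δ) (hW : LipschitzWith K W)
    (hzero : ∀ p ∉ rect δ, W p = 0) : ∃ u : H10 (dom δ), IsPolarRep u fun p => (W p : ℂ) := by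
  have hbdd : Bornology.IsBounded (rect δ) :=
    (Metric.isBounded_Ioo _ _).prod (Metric.isBounded_Ioo _ _)
  obtain ⟨V, hV, hVsupp⟩ := exists_compactSupport_approx (μ := volume) hbdd hW hzero
  refine exists_isPolarRep_of_tendstoLipschitz hδ hV hW fun n => ?_
  obtain ⟨φ, hφ, hφtest⟩ := exists_contDiff_approx (μ := volume) (isOpen_rect δ) (hV.lipschitz n)
    (hVsupp n).1 (hVsupp n).2
  refine exists_isPolarRep_of_tendstoLipschitz hδ hφ (hV.lipschitz n) fun m => ?_
  obtain ⟨hsmooth, hcomp, hsupp⟩ := hφtest m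
  exact exists_isPolarRep_of_isTest hδ (isTest_ofReal hsmooth hcomp hsupp)

end Lipschitz

/-! ### Green's formula for separated functions on rectangles -/

theorem ae_eq_Icc_prod (a b c d : ℝ) :
    Ioo a b ×ˢ Ioo c d =ᵐ[volume] Icc (a, c) (b, d) := by
  rw [← Icc_prod_Icc]
  exact Measure.set_prod_ae_eq Ioo_ae_eq_Icc Ioo_ae_eq_Icc

theorem hasFDerivAt_mul_smul {E : Type*} [NormedAddCommGroup E] [NormedSpace ℝ E] {f h : ℝ → ℝ}
    {Φ : ℝ × ℝ → E} {p : ℝ × ℝ} {df dh : ℝ} (hf : HasDerivAt f df p.1) (hh : HasDerivAt h dh p.2)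
    (hΦ : DifferentiableAt ℝ Φ p) :
    HasFDerivAt (fun q : ℝ × ℝ => (f q.1 * h q.2) • Φ q)
      ((f p.1 * h p.2) • fderiv ℝ Φ p + (f p.1 • dh • ContinuousLinearMap.snd ℝ ℝ ℝ +
        h p.2 • df • ContinuousLinearMap.fst ℝ ℝ ℝ).smulRight (Φ p)) p :=
  ((hf.comp_hasFDerivAt p hasFDerivAt_fst).mul (hh.comp_hasFDerivAt p hasFDerivAt_snd)).smul
    hΦ.hasFDerivAt

section Green

variable {E : Type*} [NormedAddCommGroup E] [NormedSpace ℝ E] {a b c d m κ : ℝ}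
  {f f' h h' : ℝ → ℝ} {Φ : ℝ × ℝ → E}

theorem integral_mul_smul_fderiv (hab : a ≤ b) (hcd : c ≤ d) (hf : ∀ x, HasDerivAt f (f' x) x)
    (hf' : ∀ x, HasDerivAt f' (-m * f x) x) (hh : ∀ y, HasDerivAt h (h' y) y)
    (hh' : ∀ y, HasDerivAt h' (κ * h y) y) (hΦ : ContDiff ℝ 1 Φ)
    (ha : ∀ y ∈ Icc c d, Φ (a, y) = 0) (hb : ∀ y ∈ Icc c d, Φ (b, y) = 0) :
    ∫ p in Ioo a b ×ˢ Ioo c d, ((f' p.1 * h p.2) • fderiv ℝ Φ p (1, 0) +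
        (f p.1 * h' p.2) • fderiv ℝ Φ p (0, 1)) =
      (m - κ) • (∫ p in Ioo a b ×ˢ Ioo c d, (f p.1 * h p.2) • Φ p) +
        (h' d • (∫ x in a..b, f x • Φ (x, d)) - h' c • ∫ x in a..b, f x • Φ (x, c)) := by
  have hfc : Continuous f := continuous_iff_continuousAt.2 fun x => (hf x).continuousAt
  have hfc' : Continuous f' := continuous_iff_continuousAt.2 fun x => (hf' x).continuousAt
  have hhc : Continuous h := continuous_iff_continuousAt.2 fun x => (hh x).continuousAt
  have hhc' : Continuous h' := continuous_iff_continuousAt.2 fun x => (hh' x).continuousAt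
  have hΦc := hΦ.continuous
  have hdΦ (v : ℝ × ℝ) : Continuous fun p => fderiv ℝ Φ p v :=
    (hΦ.continuous_fderiv one_ne_zero).clm_apply continuous_const
  have hdΦ₁ := hdΦ (1, 0)
  have hdΦ₂ := hdΦ (0, 1)
  have hd (p : ℝ × ℝ) : DifferentiableAt ℝ Φ p := hΦ.differentiable one_ne_zero p
  have hint {g : ℝ × ℝ → E} (hg : Continuous g) : IntegrableOn g (Icc (a, c) (b, d)) :=
    hg.continuousOn.integrableOn_compact isCompact_Icc
  have hdiv := integral_divergence_prod_Icc_of_hasFDerivAt_of_le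
    (fun p => (f' p.1 * h p.2) • Φ p) (fun p => (f p.1 * h' p.2) • Φ p) _ _ (a, c) (b, d)
    ⟨hab, hcd⟩ (by fun_prop) (by fun_prop)
    (fun p _ => hasFDerivAt_mul_smul (hf' p.1) (hh p.2) (hd p))
    (fun p _ => hasFDerivAt_mul_smul (hf p.1) (hh' p.2) (hd p))
    (hint (by
      simp only [neg_mul, add_apply, smul_apply, ContinuousLinearMap.smulRight_apply,
        ContinuousLinearMap.coe_snd', ContinuousLinearMap.coe_fst', smul_eq_mul, mul_zero, mul_one,
        mul_neg, zero_add, neg_smul, add_zero]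
      fun_prop))
  have hsplit (p : ℝ × ℝ) : (f' p.1 * h p.2) • fderiv ℝ Φ p (1, 0) +
      (f p.1 * h' p.2) • fderiv ℝ Φ p (0, 1) = (m - κ) • (f p.1 * h p.2) • Φ p +
        (((f' p.1 * h p.2) • fderiv ℝ Φ p + (f' p.1 • h' p.2 • ContinuousLinearMap.snd ℝ ℝ ℝ +
          h p.2 • (-m * f p.1) • ContinuousLinearMap.fst ℝ ℝ ℝ).smulRight (Φ p)) (1, 0) +
        ((f p.1 * h' p.2) • fderiv ℝ Φ p + (f p.1 • (κ * h p.2) • ContinuousLinearMap.snd ℝ ℝ ℝ +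
          h' p.2 • f' p.1 • ContinuousLinearMap.fst ℝ ℝ ℝ).smulRight (Φ p)) (0, 1)) := by
    simp only [neg_mul, add_apply, smul_apply, ContinuousLinearMap.smulRight_apply,
      ContinuousLinearMap.coe_snd', ContinuousLinearMap.coe_fst', smul_eq_mul, mul_zero, mul_one,
      mul_neg, zero_add, neg_smul, add_zero]
    module
  have hside {t : ℝ} (ht : ∀ y ∈ Icc c d, Φ (t, y) = 0) :
      ∫ y in c..d, (f' t * h y) • Φ (t, y) = 0 := by
    refine intervalIntegral.integral_zero_ae (ae_of_all _ fun y hy => ?_)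
    rw [uIoc_of_le hcd] at hy
    rw [ht y (Ioc_subset_Icc_self hy), smul_zero]
  rw [hside ha, hside hb, add_zero, sub_zero] at hdiv
  simp only [setIntegral_congr_set (ae_eq_Icc_prod a b c d), hsplit]
  rw [integral_add (hint (by fun_prop)) (hint (by
      simp only [neg_mul, add_apply, smul_apply, ContinuousLinearMap.smulRight_apply,
        ContinuousLinearMap.coe_snd', ContinuousLinearMap.coe_fst', smul_eq_mul, mul_zero, mul_one,
        mul_neg, zero_add, neg_smul, add_zero]
      fun_prop)), integral_smul, hdiv]
  simp only [mul_comm (f _), mul_smul, intervalIntegral.integral_smul]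

end Green

/-! ### Modes -/

/-- The frequencies `μ` for which `sin (μ ρ)` vanishes at both ends of `(log δ, 0)`. -/
def freq (δ : ℝ) (k : ℕ) : ℝ := k * Real.pi / -Real.log δ

theorem freq_pos {δ : ℝ} (hδ : δ ∈ Ioo (0 : ℝ) 1) {k : ℕ} (hk : 1 ≤ k) : 0 < freq δ k := by
  have hlog : 0 < -Real.log δ := neg_pos.2 (Real.log_neg hδ.1 hδ.2)
  have hk' : (0 : ℝ) < k := by exact_mod_cast hk
  exact div_pos (mul_pos hk' Real.pi_pos) hlog

theorem sin_freq_mul_log {δ : ℝ} (hδ : δ ∈ Ioo (0 : ℝ) 1) (k : ℕ) :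
    Real.sin (freq δ k * Real.log δ) = 0 := by
  rw [freq, div_neg, neg_mul, div_mul_cancel₀ _ (Real.log_neg hδ.1 hδ.2).ne, Real.sin_neg,
    Real.sin_nat_mul_pi, neg_zero]

/-- The function `sin (μ ρ) g(θ)` of logarithmic polar coordinates, where `μ = freq δ k` and `g`
is `L` in the lower sector and `R` in the upper one. -/
def sineMode (δ : ℝ) (k : ℕ) (L R : ℝ → ℝ) (p : ℝ × ℝ) : ℝ :=
  Real.sin (freq δ k * p.1) * if p.2 < Real.pi / 4 then L p.2 else R p.2

theorem exists_lipschitzWith_comp {X F : Type*} [PseudoMetricSpace X] [NormedAddCommGroup F]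
    [NormedSpace ℝ F] {K : ℝ≥0} {c : X → F} {G : F → ℝ} {S : Set F} (hc : LipschitzWith K c)
    (hG : ContDiff ℝ 1 G) (hS : IsCompact S) (hcS : ∀ x, c x ∈ S) :
    ∃ K', LipschitzWith K' (G ∘ c) := by
  obtain ⟨K', hK'⟩ := hG.locallyLipschitz.locallyLipschitzOn.exists_lipschitzOnWith_of_compact hS
  exact ⟨K' * K, lipschitzOnWith_univ.1 (hK'.comp hc.lipschitzOnWith fun x _ => hcS x)⟩

theorem exists_lipschitzWith_eqOn_sineMode {δ : ℝ} (hδ : δ ∈ Ioo (0 : ℝ) 1) (k : ℕ)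
    {L R : ℝ → ℝ} (hL : ContDiff ℝ 1 L) (hR : ContDiff ℝ 1 R) (hL0 : L 0 = 0)
    (hRpi : R Real.pi = 0) (hLR : L (Real.pi / 4) = R (Real.pi / 4)) :
    ∃ K W, LipschitzWith K W ∧ (∀ p ∉ rect δ, W p = 0) ∧ EqOn W (sineMode δ k L R) (rect δ) := by
  have hpi := Real.pi_pos
  have hlog := Real.log_neg hδ.1 hδ.2
  -- Clamping the variables extends the mode by its boundary values, which are zero.
  let c : ℝ × ℝ → ℝ × ℝ × ℝ := fun p => (max (Real.log δ) (min 0 p.1),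
    max 0 (min (Real.pi / 4) p.2), max (Real.pi / 4) (min Real.pi p.2))
  let G : ℝ × ℝ × ℝ → ℝ := fun q =>
    Real.sin (freq δ k * q.1) * (L q.2.1 + R q.2.2 - L (Real.pi / 4))
  have hc := ((LipschitzWith.prod_fst.const_min 0).const_max (Real.log δ)).prodMk
    (((LipschitzWith.prod_snd.const_min (Real.pi / 4)).const_max 0).prodMk
      ((LipschitzWith.prod_snd.const_min Real.pi).const_max (Real.pi / 4)))
  have hG : ContDiff ℝ 1 G := by fun_prop
  obtain ⟨K, hK⟩ := exists_lipschitzWith_comp (c := c) hc hG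
    (isCompact_Icc.prod (isCompact_Icc.prod isCompact_Icc)) fun p =>
      ⟨⟨le_max_left _ _, max_le hlog.le (min_le_left _ _)⟩,
        ⟨le_max_left _ _, max_le (by positivity) (min_le_left _ _)⟩,
        ⟨le_max_left _ _, max_le (by linarith) (min_le_left _ _)⟩⟩
  refine ⟨K, G ∘ c, hK, fun p hp => ?_, fun p hp => ?_⟩
  · simp only [rect, mem_prod, mem_Ioo, not_and_or, not_lt] at hp
    rcases hp with (h | h) | (h | h)
    · simp [G, c, min_eq_right (h.trans hlog.le), max_eq_left h, sin_freq_mul_log hδ k]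
    · simp [G, c, min_eq_left h, max_eq_right hlog.le]
    · simp [G, c, min_eq_right (h.trans (by positivity : (0 : ℝ) ≤ Real.pi / 4)),
        min_eq_right (h.trans hpi.le), max_eq_left h,
        max_eq_left (h.trans (by positivity : (0 : ℝ) ≤ Real.pi / 4)), hL0, hLR]
    · have h4 : Real.pi / 4 ≤ Real.pi := by linarith
      simp [G, c, min_eq_left (h4.trans h), min_eq_left h,
        max_eq_right (by positivity : (0 : ℝ) ≤ Real.pi / 4), max_eq_right h4, hRpi]
  · obtain ⟨⟨h1, h2⟩, h3, h4⟩ := hp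
    simp only [G, c, Function.comp_apply, sineMode, min_eq_right h2.le, max_eq_right h1.le,
      min_eq_right h4.le]
    split_ifs with hlt
    · rw [min_eq_right hlt.le, max_eq_right h3.le, max_eq_left hlt.le, hLR, add_sub_cancel_right]
    · rw [not_lt] at hlt
      rw [min_eq_left hlt, max_eq_right (by positivity), max_eq_right hlt, add_sub_cancel_left]

theorem exists_isPolarRep_sineMode {δ : ℝ} (hδ : δ ∈ Ioo (0 : ℝ) 1) (k : ℕ)
    {L R : ℝ → ℝ} (hL : ContDiff ℝ 1 L) (hR : ContDiff ℝ 1 R) (hL0 : L 0 = 0)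
    (hRpi : R Real.pi = 0) (hLR : L (Real.pi / 4) = R (Real.pi / 4)) :
    ∃ u : H10 (dom δ), IsPolarRep u fun p => (sineMode δ k L R p : ℂ) := by
  obtain ⟨K, W, hW, hzero, heq⟩ := exists_lipschitzWith_eqOn_sineMode hδ k hL hR hL0 hRpi hLR
  obtain ⟨u, hu⟩ := exists_isPolarRep_of_lipschitz hδ.1 hW hzero
  exact ⟨u, hu.congr fun p hp => by simp only [heq hp]⟩

theorem grad_mul_ofReal {f g : ℝ → ℝ} {f' g' : ℝ} {p : ℝ × ℝ} (hf : HasDerivAt f f' p.1)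
    (hg : HasDerivAt g g' p.2) :
    grad (fun q => ((f q.1 * g q.2 : ℝ) : ℂ)) p =
      !₂[((f' * g p.2 : ℝ) : ℂ), ((f p.1 * g' : ℝ) : ℂ)] := by
  have hd : HasFDerivAt (fun q : ℝ × ℝ => f q.1 * g q.2)
      (f p.1 • g' • ContinuousLinearMap.snd ℝ ℝ ℝ + g p.2 • f' • ContinuousLinearMap.fst ℝ ℝ ℝ) p :=
    (hf.comp_hasFDerivAt p hasFDerivAt_fst).mul (hg.comp_hasFDerivAt p hasFDerivAt_snd)
  rw [grad_ofReal hd.differentiableAt, hd.fderiv]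
  simp [mul_comm]

theorem hasDerivAt_sin_const_mul (a x : ℝ) :
    HasDerivAt (fun x => Real.sin (a * x)) (a * Real.cos (a * x)) x := by
  simpa [mul_comm] using ((hasDerivAt_id x).const_mul a).sin

theorem hasDerivAt_const_mul_cos_const_mul (a x : ℝ) :
    HasDerivAt (fun x => a * Real.cos (a * x)) (-a ^ 2 * Real.sin (a * x)) x := by
  refine ((((hasDerivAt_id x).const_mul a).cos).const_mul a).congr_deriv ?_
  simp only [id_eq]
  ring

theorem grad_sineMode {δ : ℝ} {k : ℕ} {L R : ℝ → ℝ} {p : ℝ × ℝ} {L' R' : ℝ}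
    (hp : p.2 ≠ Real.pi / 4) (hL : HasDerivAt L L' p.2) (hR : HasDerivAt R R' p.2) :
    grad (fun q => (sineMode δ k L R q : ℂ)) p =
      !₂[((freq δ k * Real.cos (freq δ k * p.1) *
          if p.2 < Real.pi / 4 then L p.2 else R p.2 : ℝ) : ℂ),
        ((Real.sin (freq δ k * p.1) * if p.2 < Real.pi / 4 then L' else R' : ℝ) : ℂ)] := by
  rcases hp.lt_or_gt with hlt | hgt
  · have heq : (fun q => (sineMode δ k L R q : ℂ)) =ᶠ[𝓝 p]
        fun q => ((Real.sin (freq δ k * q.1) * L q.2 : ℝ) : ℂ) := by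
      filter_upwards [(isOpen_lt continuous_snd continuous_const).mem_nhds hlt] with q hq
      rw [sineMode, if_pos hq]
    rw [grad, heq.fderiv_eq, if_pos hlt, if_pos hlt]
    exact grad_mul_ofReal (hasDerivAt_sin_const_mul _ _) hL
  · have heq : (fun q => (sineMode δ k L R q : ℂ)) =ᶠ[𝓝 p]
        fun q => ((Real.sin (freq δ k * q.1) * R q.2 : ℝ) : ℂ) := by
      filter_upwards [(isOpen_lt continuous_const continuous_snd).mem_nhds hgt] with q hq
      rw [sineMode, if_neg (not_lt_of_gt hq)]
    rw [grad, heq.fderiv_eq, if_neg hgt.not_gt, if_neg hgt.not_gt]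
    exact grad_mul_ofReal (hasDerivAt_sin_const_mul _ _) hR

theorem integral_rect_ite {E : Type*} [NormedAddCommGroup E] [NormedSpace ℝ E] (δ : ℝ)
    {F G : ℝ × ℝ → E} (hF : Continuous F) (hG : Continuous G) :
    ∫ p in rect δ, (if p.2 < Real.pi / 4 then F p else G p) =
      (∫ p in Ioo (Real.log δ) 0 ×ˢ Ioo 0 (Real.pi / 4), F p) +
        ∫ p in Ioo (Real.log δ) 0 ×ˢ Ioo (Real.pi / 4) Real.pi, G p := by
  have hpi := Real.pi_pos
  have hint {H : ℝ × ℝ → E} (hH : Continuous H) (a b c d : ℝ) :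
      IntegrableOn H (Ioo a b ×ˢ Ioo c d) :=
    (hH.continuousOn.integrableOn_compact (isCompact_Icc.prod isCompact_Icc)).mono_set
      (prod_mono Ioo_subset_Icc_self Ioo_subset_Icc_self)
  have hmeas (a b c d : ℝ) : MeasurableSet (Ioo a b ×ˢ Ioo c d) :=
    measurableSet_Ioo.prod measurableSet_Ioo
  have hlower : EqOn (fun p : ℝ × ℝ => if p.2 < Real.pi / 4 then F p else G p) F
      (Ioo (Real.log δ) 0 ×ˢ Ioo 0 (Real.pi / 4)) := fun p hp => if_pos hp.2.2
  have hupper : EqOn (fun p : ℝ × ℝ => if p.2 < Real.pi / 4 then F p else G p) G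
      (Ioo (Real.log δ) 0 ×ˢ Ioo (Real.pi / 4) Real.pi) := fun p hp => if_neg hp.2.1.not_gt
  have hsplit : rect δ =ᵐ[volume] (Ioo (Real.log δ) 0 ×ˢ Ioo 0 (Real.pi / 4) ∪
      Ioo (Real.log δ) 0 ×ˢ Ioo (Real.pi / 4) Real.pi : Set (ℝ × ℝ)) := by
    refine eventuallyEq_set.2 ?_
    filter_upwards [ae_snd_ne (Real.pi / 4)] with p hp
    simp only [rect, mem_union, mem_prod, mem_Ioo]
    grind
  rw [setIntegral_congr_set hsplit, setIntegral_union ?_ (hmeas _ _ _ _)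
    ((integrableOn_congr_fun hlower (hmeas _ _ _ _)).2 (hint hF _ _ _ _))
    ((integrableOn_congr_fun hupper (hmeas _ _ _ _)).2 (hint hG _ _ _ _)),
    setIntegral_congr_fun (hmeas _ _ _ _) hlower, setIntegral_congr_fun (hmeas _ _ _ _) hupper]
  exact disjoint_left.2 fun p hp hp' => hp.2.2.not_gt hp'.2.1

theorem apply_logPolar_eq_zero {δ : ℝ} (hδ : 0 < δ) {φ : ℝ × ℝ → ℂ} (hφ : IsTest (dom δ) φ)
    {p : ℝ × ℝ} (hp : p.2 ∈ Icc 0 Real.pi) (hp' : p ∉ rect δ) : φ (logPolar p) = 0 := by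
  refine image_eq_zero_of_notMem_tsupport fun hmem => hp' ?_
  rw [← logPolarInv_logPolar (by linarith [hp.1, Real.pi_pos]) hp.2]
  exact logPolarInv_mem_rect hδ (hφ.support hmem)

section Green

variable {δ c : ℝ} {k : ℕ} {L L' R R' g g' : ℝ → ℝ} {φ Φ : ℝ × ℝ → ℂ}

/-- The integrand `∇(sin (μ ρ) g(θ)) · ∇Φ` of Green's formula, where `μ = freq δ k` and `g'` is
the derivative of `g`. -/
def greenIntegrand (δ : ℝ) (k : ℕ) (g g' : ℝ → ℝ) (Φ : ℝ × ℝ → ℂ) (p : ℝ × ℝ) : ℂ :=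
  (freq δ k * Real.cos (freq δ k * p.1) * g p.2) • fderiv ℝ Φ p (1, 0) +
    (Real.sin (freq δ k * p.1) * g' p.2) • fderiv ℝ Φ p (0, 1)

theorem continuous_greenIntegrand (hg : Continuous g) (hg' : Continuous g')
    (hΦ : ContDiff ℝ 1 Φ) : Continuous (greenIntegrand δ k g g' Φ) := by
  have hfderiv (v : ℝ × ℝ) : Continuous fun p => fderiv ℝ Φ p v :=
    (hΦ.continuous_fderiv one_ne_zero).clm_apply continuous_const
  have hfst := hfderiv (1, 0)
  have hsnd := hfderiv (0, 1)
  unfold greenIntegrand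
  fun_prop

theorem inner_grad_sineMode {p : ℝ × ℝ} (hp : p.2 ≠ Real.pi / 4)
    (hL : ∀ y, HasDerivAt L (L' y) y) (hR : ∀ y, HasDerivAt R (R' y) y) :
    inner ℂ (grad (fun q => (sineMode δ k L R q : ℂ)) p) (grad Φ p) =
      if p.2 < Real.pi / 4 then greenIntegrand δ k L L' Φ p
      else greenIntegrand δ k R R' Φ p := by
  rw [grad_sineMode hp (hL _) (hR _)]
  split_ifs <;>
  simp only [greenIntegrand, PiLp.inner_apply, Fin.sum_univ_two, RCLike.inner_apply, grad,
    Matrix.cons_val_zero, Matrix.cons_val_one, Complex.conj_ofReal, Complex.real_smul, mul_comm]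

theorem integral_greenIntegrand (hδ : δ ∈ Ioo (0 : ℝ) 1) {a b : ℝ} (hab : a ≤ b) (ha : 0 ≤ a)
    (hb : b ≤ Real.pi) (hφ : IsTest (dom δ) φ) (hg : ∀ y, HasDerivAt g (g' y) y)
    (hg' : ∀ y, HasDerivAt g' (c * g y) y) :
    ∫ p in Ioo (Real.log δ) 0 ×ˢ Ioo a b, greenIntegrand δ k g g' (φ ∘ logPolar) p =
      (freq δ k ^ 2 - c) • (∫ p in Ioo (Real.log δ) 0 ×ˢ Ioo a b,
        (Real.sin (freq δ k * p.1) * g p.2) • φ (logPolar p)) +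
      (g' b • (∫ x in Real.log δ..0, Real.sin (freq δ k * x) • φ (logPolar (x, b))) -
        g' a • ∫ x in Real.log δ..0, Real.sin (freq δ k * x) • φ (logPolar (x, a))) := by
  refine integral_mul_smul_fderiv (Φ := φ ∘ logPolar) (Real.log_neg hδ.1 hδ.2).le hab
    (hasDerivAt_sin_const_mul _) (hasDerivAt_const_mul_cos_const_mul _) hg hg'
    ((hφ.smooth.comp contDiff_logPolar).of_le (by simp)) (fun y hy => ?_) fun y hy => ?_
  · exact apply_logPolar_eq_zero hδ.1 hφ ⟨ha.trans hy.1, hy.2.trans hb⟩ fun h => h.1.1.false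
  · exact apply_logPolar_eq_zero hδ.1 hφ ⟨ha.trans hy.1, hy.2.trans hb⟩ fun h => h.1.2.false

theorem integral_rect_sineMode_smul (σp σm : ℝ) (hφ : IsTest (dom δ) φ) (hL : Continuous L)
    (hR : Continuous R) :
    ∫ p in rect δ,
      ((if p.2 < Real.pi / 4 then σm else σp) * sineMode δ k L R p) • φ (logPolar p) =
    σm • (∫ p in Ioo (Real.log δ) 0 ×ˢ Ioo 0 (Real.pi / 4),
        (Real.sin (freq δ k * p.1) * L p.2) • φ (logPolar p)) +
      σp • ∫ p in Ioo (Real.log δ) 0 ×ˢ Ioo (Real.pi / 4) Real.pi,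
        (Real.sin (freq δ k * p.1) * R p.2) • φ (logPolar p) := by
  have hφc := hφ.smooth.continuous
  have hlog := contDiff_logPolar.continuous
  rw [← integral_smul, ← integral_smul, ← integral_rect_ite δ (by fun_prop) (by fun_prop)]
  refine integral_congr_ae (Eventually.of_forall fun p => ?_)
  simp only [sineMode]
  split_ifs <;> rw [mul_smul]

theorem A_apply_sineMode (hδ : δ ∈ Ioo (0 : ℝ) 1) (σp σm : ℝ) (hφ : IsTest (dom δ) φ)
    {u e : H10 (dom δ)} (hu : IsPolarRep u (φ ∘ logPolar))
    (he : IsPolarRep e fun p => (sineMode δ k L R p : ℂ))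
    (hL : ∀ y, HasDerivAt L (L' y) y) (hL' : ∀ y, HasDerivAt L' (c * L y) y)
    (hR : ∀ y, HasDerivAt R (R' y) y) (hR' : ∀ y, HasDerivAt R' (c * R y) y) :
    A δ σp σm u e =
      (freq δ k ^ 2 - c) • (∫ p in rect δ,
        ((if p.2 < Real.pi / 4 then σm else σp) * sineMode δ k L R p) • φ (logPolar p)) +
      (σm * L' (Real.pi / 4) - σp * R' (Real.pi / 4)) •
        ∫ x in Real.log δ..0, Real.sin (freq δ k * x) • φ (logPolar (x, Real.pi / 4)) := by
  have hpi := Real.pi_pos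
  have hΦ : ContDiff ℝ 1 (φ ∘ logPolar) := (hφ.smooth.comp contDiff_logPolar).of_le (by simp)
  have hcont {g g' : ℝ → ℝ} (h : ∀ y, HasDerivAt g (g' y) y) : Continuous g :=
    continuous_iff_continuousAt.2 fun y => (h y).continuousAt
  have hboundary {x y : ℝ} (hy : y = 0 ∨ y = Real.pi) : φ (logPolar (x, y)) = 0 :=
    apply_logPolar_eq_zero hδ.1 hφ (by grind) fun h => by grind [rect]
  have hsplit : A δ σp σm u e = ∫ p in rect δ, if p.2 < Real.pi / 4 then
      σm • greenIntegrand δ k L L' (φ ∘ logPolar) p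
      else σp • greenIntegrand δ k R R' (φ ∘ logPolar) p := by
    rw [A_apply_eq_integral_polarGrad hδ.1]
    refine integral_congr_ae ?_
    filter_upwards [hu, he, ae_restrict_of_ae (ae_snd_ne (Real.pi / 4))] with p hp hpe hne
    rw [hp.2, hpe.2, inner_grad_sineMode hne hL hR]
    split_ifs <;> exact (Complex.real_smul ..).symm
  have hGL := continuous_greenIntegrand (δ := δ) (k := k) (hcont hL) (hcont hL') hΦ
  have hGR := continuous_greenIntegrand (δ := δ) (k := k) (hcont hR) (hcont hR') hΦ
  rw [hsplit, integral_rect_ite δ (by fun_prop) (by fun_prop), integral_smul, integral_smul,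
    integral_greenIntegrand hδ (by positivity) le_rfl (by linarith) hφ hL hL',
    integral_greenIntegrand hδ (by linarith) (by positivity) le_rfl hφ hR hR',
    integral_rect_sineMode_smul σp σm hφ (hcont hL) (hcont hR)]
  simp only [hboundary (Or.inl rfl), hboundary (Or.inr rfl), smul_zero,
    intervalIntegral.integral_zero, sub_zero, zero_sub]
  module

end Green

/-! ### Eigenvectors of `A δ σp σm` relative to `A δ 1 1` -/

section Eigenvectors

variable {δ σp σm : ℝ} {k : ℕ}

theorem A_apply_conj (δ σp σm : ℝ) (u v : H10 (dom δ)) :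
    A δ σp σm u v = starRingEnd ℂ (A δ σp σm v u) := by
  rw [A_apply, A_apply, ← integral_conj]
  congr 1
  ext x
  rw [map_mul, Complex.conj_ofReal, inner_conj_symm]

theorem mem_pencilEigenspace_A {l : ℝ} {e : H10 (dom δ)}
    (h : ∀ v, A δ σp σm v e = l * A δ 1 1 v e) :
    e ∈ pencilEigenspace (A δ σp σm) (A δ 1 1) l := by
  refine mem_pencilEigenspace.2 fun v => ?_
  rw [A_apply_conj, h, map_mul, Complex.conj_ofReal, ← A_apply_conj]

theorem mem_pencilEigenspace_of_ae {l : ℝ} (hδ : 0 < δ) {e : H10 (dom δ)}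
    (h : ∀ᵐ p ∂volume.restrict (rect δ),
      polarGrad e p = 0 ∨ (if p.2 < Real.pi / 4 then σm else σp) = l) :
    e ∈ pencilEigenspace (A δ σp σm) (A δ 1 1) l := by
  refine mem_pencilEigenspace_A fun v => ?_
  rw [A_apply_eq_integral_polarGrad hδ, A_apply_eq_integral_polarGrad hδ, ← integral_const_mul]
  refine integral_congr_ae ?_
  filter_upwards [h] with p hp
  rcases hp with h0 | hl
  · simp [h0]
  · rw [hl, ite_self, Complex.ofReal_one, one_mul]

theorem mem_pencilEigenspace_of_isPolarRep_lower (hδ : 0 < δ) {L : ℝ → ℝ}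
    (hL : Differentiable ℝ L) {e : H10 (dom δ)}
    (he : IsPolarRep e fun p => (sineMode δ k L 0 p : ℂ)) :
    e ∈ pencilEigenspace (A δ σp σm) (A δ 1 1) σm := by
  refine mem_pencilEigenspace_of_ae hδ ?_
  filter_upwards [he, ae_restrict_of_ae (ae_snd_ne (Real.pi / 4))] with p hp hne
  refine or_iff_not_imp_right.2 fun h => ?_
  have hp' : ¬p.2 < Real.pi / 4 := fun hlt => h (if_pos hlt)
  rw [hp.2, grad_sineMode hne (hL _).hasDerivAt ((hasDerivAt_zero p.2))]
  ext i
  fin_cases i <;> simp [hp']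

theorem mem_pencilEigenspace_of_isPolarRep_upper (hδ : 0 < δ) {R : ℝ → ℝ}
    (hR : Differentiable ℝ R) {e : H10 (dom δ)}
    (he : IsPolarRep e fun p => (sineMode δ k 0 R p : ℂ)) :
    e ∈ pencilEigenspace (A δ σp σm) (A δ 1 1) σp := by
  refine mem_pencilEigenspace_of_ae hδ ?_
  filter_upwards [he, ae_restrict_of_ae (ae_snd_ne (Real.pi / 4))] with p hp hne
  refine or_iff_not_imp_right.2 fun h => ?_
  have hp' : p.2 < Real.pi / 4 := not_not.1 fun hlt => h (if_neg hlt)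
  rw [hp.2, grad_sineMode hne ((hasDerivAt_zero p.2)) (hR _).hasDerivAt]
  ext i
  fin_cases i <;> simp [hp']

/-- The angular factor, in the lower sector, of the harmonic functions that vanish on the boundary
of the half-annulus and are continuous across the interface `θ = π / 4`. -/
def interfaceLower (μ θ : ℝ) : ℝ := Real.sinh (μ * θ) * Real.sinh (μ * (Real.pi - Real.pi / 4))

/-- The analogue of `interfaceLower` in the upper sector. -/
def interfaceUpper (μ θ : ℝ) : ℝ := Real.sinh (μ * (Real.pi / 4)) * Real.sinh (μ * (Real.pi - θ))

theorem contDiff_interfaceLower (μ : ℝ) : ContDiff ℝ 1 (interfaceLower μ) := by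
  unfold interfaceLower
  fun_prop

theorem contDiff_interfaceUpper (μ : ℝ) : ContDiff ℝ 1 (interfaceUpper μ) := by
  unfold interfaceUpper
  fun_prop

theorem hasDerivAt_interfaceLower (μ θ : ℝ) : HasDerivAt (interfaceLower μ)
    (μ * Real.cosh (μ * θ) * Real.sinh (μ * (Real.pi - Real.pi / 4))) θ := by
  refine (((hasDerivAt_id θ).const_mul μ).sinh.mul_const _).congr_deriv ?_
  simp only [id_eq]
  ring

theorem hasDerivAt_interfaceUpper (μ θ : ℝ) : HasDerivAt (interfaceUpper μ)
    (-μ * Real.sinh (μ * (Real.pi / 4)) * Real.cosh (μ * (Real.pi - θ))) θ := by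
  refine ((((hasDerivAt_id θ).const_sub Real.pi).const_mul μ).sinh.const_mul _).congr_deriv ?_
  simp only [id_eq]
  ring

theorem hasDerivAt_deriv_interfaceLower (μ θ : ℝ) :
    HasDerivAt (fun θ => μ * Real.cosh (μ * θ) * Real.sinh (μ * (Real.pi - Real.pi / 4)))
      (μ ^ 2 * interfaceLower μ θ) θ := by
  refine ((((hasDerivAt_id θ).const_mul μ).cosh.const_mul μ).mul_const _).congr_deriv ?_
  simp only [id_eq, interfaceLower]
  ring

theorem hasDerivAt_deriv_interfaceUpper (μ θ : ℝ) :
    HasDerivAt (fun θ => -μ * Real.sinh (μ * (Real.pi / 4)) * Real.cosh (μ * (Real.pi - θ)))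
      (μ ^ 2 * interfaceUpper μ θ) θ := by
  refine ((((hasDerivAt_id θ).const_sub Real.pi).const_mul μ).cosh.const_mul _).congr_deriv ?_
  simp only [id_eq, interfaceUpper]
  ring

/-- The eigenvalue of `A δ σp σm` relative to `A δ 1 1` that belongs to the function
`sineMode δ k (interfaceLower μ) (interfaceUpper μ)`, where `μ = freq δ k`. -/
def interfaceEigenvalue (δ σp σm : ℝ) (k : ℕ) : ℝ :=
  (σp + σm) / 2 - (σp - σm) / (4 * Real.cosh (freq δ k * (Real.pi / 2)))

/-- The flux jump `σ₋ ∂_θ e - σ₊ ∂_θ e` across the interface is proportional to the one for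
`σ₋ = σ₊ = 1`. -/
theorem flux_interface (σp σm μ : ℝ) :
    σm * (μ * Real.cosh (μ * (Real.pi / 4)) * Real.sinh (μ * (Real.pi - Real.pi / 4))) -
      σp * (-μ * Real.sinh (μ * (Real.pi / 4)) * Real.cosh (μ * (Real.pi - Real.pi / 4))) =
    ((σp + σm) / 2 - (σp - σm) / (4 * Real.cosh (μ * (Real.pi / 2)))) *
      (1 * (μ * Real.cosh (μ * (Real.pi / 4)) * Real.sinh (μ * (Real.pi - Real.pi / 4))) -
        1 * (-μ * Real.sinh (μ * (Real.pi / 4)) * Real.cosh (μ * (Real.pi - Real.pi / 4)))) := by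
  have hsum : μ * (Real.pi - Real.pi / 4) + μ * (Real.pi / 4) = 2 * (μ * (Real.pi / 2)) := by ring
  have hdiff : μ * (Real.pi - Real.pi / 4) - μ * (Real.pi / 4) = μ * (Real.pi / 2) := by ring
  have hsinh_sum := Real.sinh_two_mul (μ * (Real.pi / 2))
  rw [← hsum, Real.sinh_add, mul_right_comm,
    mul_comm (2 * _), ← div_eq_iff (mul_ne_zero two_ne_zero (Real.cosh_pos _).ne')] at hsinh_sum
  have hsinh_diff := congrArg Real.sinh hdiff
  rw [Real.sinh_sub] at hsinh_diff
  linear_combination μ * (σp - σm) / 2 * (hsinh_sum - hsinh_diff)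

end Eigenvectors

section InterfaceModes

variable {δ σp σm : ℝ} {k : ℕ}

theorem interfaceLower_pos {μ θ : ℝ} (hμ : 0 < μ) (hθ : 0 < θ) : 0 < interfaceLower μ θ :=
  mul_pos (Real.sinh_pos_iff.2 (mul_pos hμ hθ))
    (Real.sinh_pos_iff.2 (mul_pos hμ (by linarith [Real.pi_pos])))

theorem exists_isPolarRep_interface (hδ : δ ∈ Ioo (0 : ℝ) 1) (k : ℕ) :
    ∃ e : H10 (dom δ), IsPolarRep e fun p =>
      (sineMode δ k (interfaceLower (freq δ k)) (interfaceUpper (freq δ k)) p : ℂ) :=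
  exists_isPolarRep_sineMode hδ k (contDiff_interfaceLower _) (contDiff_interfaceUpper _)
    (by simp [interfaceLower]) (by simp [interfaceUpper]) rfl

theorem mem_pencilEigenspace_interfaceEigenvalue (hδ : δ ∈ Ioo (0 : ℝ) 1) {e : H10 (dom δ)}
    (he : IsPolarRep e fun p =>
      (sineMode δ k (interfaceLower (freq δ k)) (interfaceUpper (freq δ k)) p : ℂ)) :
    e ∈ pencilEigenspace (A δ σp σm) (A δ 1 1) (interfaceEigenvalue δ σp σm k) := by
  refine mem_pencilEigenspace_A (congrFun (eq_of_forall_isTest (by fun_prop) (by fun_prop)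
    fun u φ hφ hu hgrad => ?_))
  have hrep := isPolarRep_comp_logPolar hδ.1 (hφ.smooth.differentiable (by simp)) hu hgrad
  have happly (s t : ℝ) := A_apply_sineMode hδ s t hφ hrep he (hasDerivAt_interfaceLower _)
    (hasDerivAt_deriv_interfaceLower _) (hasDerivAt_interfaceUpper _)
    (hasDerivAt_deriv_interfaceUpper _)
  simp only [happly, sub_self, zero_smul, zero_add]
  rw [flux_interface, mul_smul, interfaceEigenvalue, Complex.real_smul]

theorem IsPolarRep.ae_eq_zero (hδ : 0 < δ) {f : ℝ × ℝ → ℂ}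
    (hf : IsPolarRep (0 : H10 (dom δ)) f) : f =ᵐ[volume.restrict (rect δ)] 0 := by
  have h0 : ∀ᵐ x ∂volume.restrict (dom δ), (0 : H10 (dom δ)).1.fst x = 0 := Lp.coeFn_zero ..
  filter_upwards [hf, (ae_restrict_dom_iff hδ).1 h0] with p hp hp0
  exact hp.1.symm.trans hp0

theorem ne_zero_of_isPolarRep_interface (hδ : δ ∈ Ioo (0 : ℝ) 1) (hk : 1 ≤ k) {e : H10 (dom δ)}
    (he : IsPolarRep e fun p =>
      (sineMode δ k (interfaceLower (freq δ k)) (interfaceUpper (freq δ k)) p : ℂ)) : e ≠ 0 := by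
  rintro rfl
  have hpi := Real.pi_pos
  have hlog := Real.log_neg hδ.1 hδ.2
  have hk' : (1 : ℝ) ≤ k := by exact_mod_cast hk
  let U : Set (ℝ × ℝ) := Ioo (Real.log δ) 0 ×ˢ Ioo 0 (Real.pi / 4)
  have hU : IsOpen U := isOpen_Ioo.prod isOpen_Ioo
  have hae : (fun p : ℝ × ℝ => Real.sin (freq δ k * p.1) * interfaceLower (freq δ k) p.2)
      =ᵐ[volume.restrict U] fun _ => 0 := by
    have hsub : U ⊆ rect δ := prod_mono le_rfl (Ioo_subset_Ioo_right (by linarith))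
    filter_upwards [ae_restrict_of_ae_restrict_of_subset hsub (he.ae_eq_zero hδ.1),
      ae_restrict_mem hU.measurableSet] with p hp hmem
    have hp' := Complex.ofReal_eq_zero.1 hp
    rwa [sineMode, if_pos hmem.2.2] at hp'
  have hcont := (contDiff_interfaceLower (freq δ k)).continuous
  have heq := Measure.eqOn_open_of_ae_eq hae hU (by fun_prop) (by fun_prop)
  have hρ : freq δ k * (Real.log δ / (2 * k)) = -(Real.pi / 2) := by
    have := hlog.ne
    rw [freq]
    field_simp
  have hmem : (Real.log δ / (2 * k), Real.pi / 8) ∈ U := by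
    refine ⟨⟨?_, div_neg_of_neg_of_pos hlog (by positivity)⟩, by positivity, by simp only; linarith⟩
    rw [lt_div_iff₀ (by positivity)]
    nlinarith
  have hvalue := heq hmem
  simp only [hρ, Real.sin_neg, Real.sin_pi_div_two] at hvalue
  linarith [interfaceLower_pos (freq_pos hδ hk) (by positivity : 0 < Real.pi / 8)]

theorem eq_smul_add_add_of_isPolarRep (hδ : 0 < δ) {u u₁ u₂ u₃ : H10 (dom δ)}
    {f f₁ f₂ f₃ : ℝ × ℝ → ℂ} {a : ℂ} (hu : IsPolarRep u f) (hu₁ : IsPolarRep u₁ f₁)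
    (hu₂ : IsPolarRep u₂ f₂) (hu₃ : IsPolarRep u₃ f₃) (h : ∀ p, f p = a * f₁ p + f₂ p + f₃ p) :
    u = a • u₁ + u₂ + u₃ := by
  refine sub_eq_zero.1 (eq_zero_of_fst_ae_eq_zero (isOpen_dom hδ) ?_)
  change u.1.fst - (a • u₁.1.fst + u₂.1.fst + u₃.1.fst) =ᵐ[volume.restrict (dom δ)] 0
  have hrep : ∀ᵐ x ∂volume.restrict (dom δ),
      u.1.fst x = a * u₁.1.fst x + u₂.1.fst x + u₃.1.fst x := by
    refine (ae_restrict_dom_iff hδ).2 ?_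
    filter_upwards [hu, hu₁, hu₂, hu₃] with p hp hp₁ hp₂ hp₃
    rw [hp.1, hp₁.1, hp₂.1, hp₃.1, h]
  filter_upwards [hrep, Lp.coeFn_sub u.1.fst (a • u₁.1.fst + u₂.1.fst + u₃.1.fst),
    Lp.coeFn_add (a • u₁.1.fst + u₂.1.fst) u₃.1.fst, Lp.coeFn_add (a • u₁.1.fst) u₂.1.fst,
    Lp.coeFn_smul a u₁.1.fst] with x hx hsub hadd hadd' hsmul
  rw [hsub, Pi.sub_apply, hadd, Pi.add_apply, hadd', Pi.add_apply, hsmul, Pi.smul_apply, hx,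
    smul_eq_mul, sub_self, Pi.zero_apply]

/-- Subtracting from `g` the multiple of the interface mode with the same value at `θ = π / 4`
leaves a function that splits into one supported in each sector. -/
theorem exists_isPolarRep_sineMode_mem_sup (hδ : δ ∈ Ioo (0 : ℝ) 1) (hk : 1 ≤ k) {g : ℝ → ℝ}
    (hg : ContDiff ℝ 1 g) (hg0 : g 0 = 0) (hgpi : g Real.pi = 0) :
    ∃ s : H10 (dom δ), IsPolarRep s (fun p => (sineMode δ k g g p : ℂ)) ∧
      s ∈ pencilEigenspace (A δ σp σm) (A δ 1 1) (interfaceEigenvalue δ σp σm k) ⊔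
        pencilEigenspace (A δ σp σm) (A δ 1 1) σm ⊔
        pencilEigenspace (A δ σp σm) (A δ 1 1) σp := by
  set μ := freq δ k
  obtain ⟨a, ha⟩ : ∃ a, g (Real.pi / 4) - a * interfaceLower μ (Real.pi / 4) = 0 :=
    ⟨_, sub_eq_zero.2 (div_mul_cancel₀ _
      (interfaceLower_pos (freq_pos hδ hk) (by positivity)).ne').symm⟩
  have hL : ContDiff ℝ 1 fun θ => g θ - a * interfaceLower μ θ :=
    hg.sub (contDiff_const.mul (contDiff_interfaceLower μ))
  have hR : ContDiff ℝ 1 fun θ => g θ - a * interfaceUpper μ θ :=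
    hg.sub (contDiff_const.mul (contDiff_interfaceUpper μ))
  obtain ⟨s, hs⟩ := exists_isPolarRep_sineMode hδ k hg hg hg0 hgpi rfl
  obtain ⟨e, he⟩ := exists_isPolarRep_interface hδ k
  obtain ⟨l, hl⟩ := exists_isPolarRep_sineMode (R := 0) hδ k hL contDiff_const
    (by simp [hg0, interfaceLower]) rfl ha
  obtain ⟨r, hr⟩ := exists_isPolarRep_sineMode (L := 0) hδ k contDiff_const hR
    rfl (by simp [hgpi, interfaceUpper]) ha.symm
  have hdecomp : s = (a : ℂ) • e + l + r := by
    refine eq_smul_add_add_of_isPolarRep hδ.1 hs he hl hr fun p => ?_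
    simp only [sineMode, Pi.zero_apply]
    split_ifs <;> push_cast <;> ring
  refine ⟨s, hs, hdecomp ▸ add_mem (add_mem (Submodule.mem_sup_left (Submodule.mem_sup_left ?_))
    (Submodule.mem_sup_left (Submodule.mem_sup_right ?_))) (Submodule.mem_sup_right ?_)⟩
  · exact Submodule.smul_mem _ _ (mem_pencilEigenspace_interfaceEigenvalue hδ he)
  · exact mem_pencilEigenspace_of_isPolarRep_lower hδ.1 (hL.differentiable one_ne_zero) hl
  · exact mem_pencilEigenspace_of_isPolarRep_upper hδ.1 (hR.differentiable one_ne_zero) hr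

end InterfaceModes

section Completeness

variable {δ σp σm : ℝ} {k : ℕ}

theorem continuous_integral_rect_smul (hδ : 0 < δ) {g : ℝ × ℝ → ℝ} (hg : Continuous g) {C : ℝ}
    (hC : ∀ p, |g p| ≤ C) :
    Continuous fun u : H10 (dom δ) => ∫ p in rect δ, g p • u.1.fst (logPolar p) := by
  let ψ : ℝ × ℝ → ℂ := fun x => (Real.exp (-(logPolarInv x).1) ^ 2 * g (logPolarInv x) : ℝ)
  have hint (u : H10 (dom δ)) :
      ∫ p in rect δ, g p • u.1.fst (logPolar p) = ∫ x in dom δ, ψ x * u.1.fst x := by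
    rw [integral_dom hδ]
    refine setIntegral_congr_fun (measurableSet_rect δ) fun p hp => ?_
    have hexp : Real.exp p.1 ^ 2 * (Real.exp (-p.1) ^ 2 * g p) = g p := by
      rw [← mul_assoc, ← mul_pow, ← Real.exp_add, add_neg_cancel, Real.exp_zero, one_pow, one_mul]
    simp only [ψ, logPolarInv_logPolar_of_mem hp]
    rw [← Complex.real_smul, smul_smul, hexp]
  have hcont : ContinuousOn ψ (dom δ) := by
    have hinv : ContinuousOn logPolarInv (dom δ) := fun x hx =>
      (contDiffAt_logPolarInv (snd_pos_of_mem_dom hδ hx)).continuousAt.continuousWithinAt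
    exact Complex.continuous_ofReal.comp_continuousOn (((by fun_prop : Continuous fun p : ℝ × ℝ =>
      Real.exp (-p.1) ^ 2 * g p)).comp_continuousOn hinv)
  have hbound : ∀ x ∈ dom δ, ‖ψ x‖ ≤ δ⁻¹ ^ 2 * C := fun x hx => by
    have hexp := exp_neg_fst_le_inv hδ (logPolarInv_mem_rect hδ hx)
    rw [Complex.norm_real, norm_mul, norm_pow, Real.norm_of_nonneg (Real.exp_pos _).le]
    exact mul_le_mul (pow_le_pow_left₀ (Real.exp_pos _).le hexp 2) (hC _) (abs_nonneg _)
      (by positivity)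
  have : IsFiniteMeasure (volume.restrict (dom δ)) := ⟨by simpa using volume_dom_lt_top hδ⟩
  have hψ : MemLp ψ 2 (volume.restrict (dom δ)) :=
    MemLp.of_bound (hcont.aestronglyMeasurable (measurableSet_dom δ)) _
      ((ae_restrict_iff' (measurableSet_dom δ)).2 (Eventually.of_forall hbound))
  simp only [hint]
  exact (continuous_integral_mul_Lp hψ).comp
    ((WithLp.prod_continuous_ofLp ..).fst.comp continuous_subtype_val)

theorem A_one_one_apply_sine (hδ : δ ∈ Ioo (0 : ℝ) 1) (j : ℕ) {s : H10 (dom δ)}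
    (hs : IsPolarRep s fun p => (sineMode δ k (fun θ => Real.sin (j * θ))
      (fun θ => Real.sin (j * θ)) p : ℂ)) (u : H10 (dom δ)) :
    A δ 1 1 u s = (freq δ k ^ 2 + j ^ 2) •
      ∫ p in rect δ, (Real.sin (freq δ k * p.1) * Real.sin (j * p.2)) • u.1.fst (logPolar p) := by
  have hint := continuous_integral_rect_smul hδ.1 (C := 1)
    (by fun_prop : Continuous fun p : ℝ × ℝ => Real.sin (freq δ k * p.1) * Real.sin (j * p.2))
    fun p => (abs_mul _ _).trans_le
      (mul_le_one₀ (Real.abs_sin_le_one _) (abs_nonneg _) (Real.abs_sin_le_one _))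
  refine congrFun (eq_of_forall_isTest (F := fun u => A δ 1 1 u s) (by fun_prop)
    (hint.const_smul (freq δ k ^ 2 + (j : ℝ) ^ 2)) fun u φ hφ hu hgrad => ?_) u
  have hrep := isPolarRep_comp_logPolar hδ.1 (hφ.smooth.differentiable (by simp)) hu hgrad
  have hsin := hasDerivAt_sin_const_mul (j : ℝ)
  have hcos := hasDerivAt_const_mul_cos_const_mul (j : ℝ)
  rw [A_apply_sineMode hδ 1 1 hφ hrep hs hsin hcos hsin hcos, sub_self, zero_smul, add_zero,
    sub_neg_eq_add]
  congr 1
  refine integral_congr_ae ?_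
  filter_upwards [hrep] with p hp
  rw [hp.1, sineMode, ite_self, ite_self, one_mul, Function.comp_apply]

/-- The eigenvalues of `A^δ` relative to the Dirichlet Laplacian `A δ 1 1`: the two values of the
coefficient, attained on functions supported in one of the two subdomains, and those of the modes
concentrated at the interface. -/
def relativeEigenvalues (δ σp σm : ℝ) : Set ℝ :=
  {σp, σm} ∪ interfaceEigenvalue δ σp σm '' Ici 1

theorem integral_sin_mul_sin_smul_eq_zero (hδ : δ ∈ Ioo (0 : ℝ) 1) {u : H10 (dom δ)}
    (h : ∀ l ∈ relativeEigenvalues δ σp σm, ∀ e ∈ pencilEigenspace (A δ σp σm) (A δ 1 1) l,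
      A δ 1 1 u e = 0) (k j : ℕ) :
    ∫ p in rect δ, (Real.sin (freq δ k * p.1) * Real.sin (j * p.2)) •
      u.1.fst (logPolar p) = 0 := by
  rcases Nat.eq_zero_or_pos k with rfl | hk
  · simp [freq]
  obtain ⟨s, hs, hmem⟩ := exists_isPolarRep_sineMode_mem_sup (σp := σp) (σm := σm) hδ hk
    (g := fun θ => Real.sin (j * θ)) (by fun_prop) (by simp) (Real.sin_nat_mul_pi j)
  have hker : pencilEigenspace (A δ σp σm) (A δ 1 1) (interfaceEigenvalue δ σp σm k) ⊔
      pencilEigenspace (A δ σp σm) (A δ 1 1) σm ⊔ pencilEigenspace (A δ σp σm) (A δ 1 1) σp ≤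
      LinearMap.ker (A δ 1 1 u).toLinearMap := sup_le
    (sup_le (h _ (.inr ⟨k, hk, rfl⟩)) (h _ (.inl (.inr rfl)))) (h _ (.inl (.inl rfl)))
  have hzero : A δ 1 1 u s = 0 := hker hmem
  rw [A_one_one_apply_sine hδ j hs] at hzero
  have hμ := freq_pos hδ hk
  exact (smul_eq_zero.1 hzero).resolve_left (by positivity)

theorem freq_one_mul_neg_log (hδ : δ ∈ Ioo (0 : ℝ) 1) : freq δ 1 * -Real.log δ = Real.pi := by
  rw [freq, Nat.cast_one, one_mul, div_mul_cancel₀ _ (neg_ne_zero.2 (Real.log_neg hδ.1 hδ.2).ne)]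

theorem sin_freq_mul_sin_ne_zero (hδ : δ ∈ Ioo (0 : ℝ) 1) {p : ℝ × ℝ} (hp : p ∈ rect δ) :
    Real.sin (freq δ 1 * p.1) * Real.sin p.2 ≠ 0 := by
  have hneg : Real.sin (freq δ 1 * p.1) < 0 := by
    refine Real.sin_neg_of_neg_of_neg_pi_lt (mul_neg_of_pos_of_neg (freq_pos hδ le_rfl) hp.1.2) ?_
    rw [← freq_one_mul_neg_log hδ, ← mul_neg, neg_neg]
    exact mul_lt_mul_of_pos_left hp.1.1 (freq_pos hδ le_rfl)
  exact (mul_neg_of_neg_of_pos hneg (Real.sin_pos_of_pos_of_lt_pi hp.2.1 hp.2.2)).ne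

theorem exists_continuousMap_comp_cos_eq (hδ : δ ∈ Ioo (0 : ℝ) 1) {ψ : ℝ × ℝ → ℝ}
    (hψ : Continuous ψ) :
    ∃ F : C(ℝ × ℝ, ℝ), ∀ p ∈ rect δ, F (Real.cos (freq δ 1 * p.1), Real.cos p.2) = ψ p := by
  refine ⟨⟨fun q => ψ (-(Real.arccos q.1 / freq δ 1), Real.arccos q.2), by fun_prop⟩,
    fun p hp => ?_⟩
  have hμ := freq_pos hδ le_rfl
  have hle : -(freq δ 1 * p.1) ≤ Real.pi := by
    rw [← freq_one_mul_neg_log hδ, ← mul_neg]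
    exact mul_le_mul_of_nonneg_left (neg_le_neg hp.1.1.le) hμ.le
  rw [ContinuousMap.coe_mk, ← Real.cos_neg, Real.arccos_cos _ hle,
    Real.arccos_cos hp.2.1.le hp.2.2.le, neg_div, neg_neg, mul_div_cancel_left₀ _ hμ.ne']
  exact neg_nonneg.2 (mul_nonpos_of_nonneg_of_nonpos hμ.le hp.1.2.le)

theorem ae_eq_zero_of_forall_integral_sin_mul_sin (hδ : δ ∈ Ioo (0 : ℝ) 1) {w : ℝ × ℝ → ℂ}
    (hw : IntegrableOn w (rect δ)) (h : ∀ k j : ℕ,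
      ∫ p in rect δ, (Real.sin (freq δ k * p.1) * Real.sin (j * p.2)) • w p = 0) :
    ∀ᵐ p ∂volume.restrict (rect δ), w p = 0 := by
  let S : ℝ × ℝ → ℝ := fun p => Real.sin (freq δ 1 * p.1) * Real.sin p.2
  have hfreq (k : ℕ) : freq δ k = k * freq δ 1 := by
    rw [freq, freq, Nat.cast_one, one_mul, mul_div_assoc]
  have hS : IntegrableOn (fun p => S p • w p) (rect δ) :=
    Integrable.bdd_smul hw 1 (by fun_prop : Continuous S).aestronglyMeasurable
      (Eventually.of_forall fun p => (abs_mul _ _).trans_le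
        (mul_le_one₀ (Real.abs_sin_le_one _) (abs_nonneg _) (Real.abs_sin_le_one _)))
  have hae : ∀ᵐ p, p ∈ rect δ → S p • w p = 0 := by
    refine (isOpen_rect δ).ae_eq_zero_of_integral_contDiff_smul_eq_zero hS.locallyIntegrableOn
      fun ψ hψ _ hsupp => ?_
    obtain ⟨F, hF⟩ := exists_continuousMap_comp_cos_eq hδ hψ.continuous
    rw [← setIntegral_eq_integral_of_forall_compl_eq_zero (s := rect δ) fun p hp => by
      rw [image_eq_zero_of_notMem_tsupport fun hmem => hp (hsupp hmem), zero_smul]]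
    rw [← integral_comp_cos_mul_sin_smul_eq_zero (μ := volume.restrict (rect δ)) hw
      (a := fun p => freq δ 1 * p.1) (b := Prod.snd) (by fun_prop) measurable_snd
      (fun k j => by simpa only [hfreq k, mul_assoc] using h k j) F]
    refine setIntegral_congr_fun (measurableSet_rect δ) fun p hp => ?_
    simp only [hF p hp, S, smul_smul]
  filter_upwards [(ae_restrict_iff' (measurableSet_rect δ)).2 hae,
    ae_restrict_mem (measurableSet_rect δ)] with p hp hmem
  exact (smul_eq_zero.1 hp).resolve_left (sin_freq_mul_sin_ne_zero hδ hmem)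

theorem integrableOn_comp_logPolar (hδ : 0 < δ) {f : ℝ × ℝ → ℂ} (hf : IntegrableOn f (dom δ)) :
    IntegrableOn (f ∘ logPolar) (rect δ) := by
  rw [← image_logPolar hδ, integrableOn_image_iff_integrableOn_abs_det_fderiv_smul volume
    (measurableSet_rect δ) (fun p _ => (hasFDerivAt_logPolar p).hasFDerivWithinAt)
    (injOn_logPolar δ)] at hf
  have hbound : ∀ᵐ p ∂volume.restrict (rect δ), ‖Real.exp (-p.1) ^ 2‖ ≤ δ⁻¹ ^ 2 := by
    filter_upwards [ae_restrict_mem (measurableSet_rect δ)] with p hp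
    rw [norm_pow, Real.norm_of_nonneg (Real.exp_pos _).le]
    exact pow_le_pow_left₀ (Real.exp_pos _).le (exp_neg_fst_le_inv hδ hp) 2
  refine (Integrable.bdd_smul hf _ (by fun_prop : Continuous fun p : ℝ × ℝ =>
    Real.exp (-p.1) ^ 2).aestronglyMeasurable hbound).congr (Eventually.of_forall fun p => ?_)
  simp only [Pi.smul_apply', det_logPolarDeriv, Function.comp_apply]
  rw [abs_of_nonneg (by positivity), smul_smul, ← mul_pow, ← Real.exp_add, neg_add_cancel,
    Real.exp_zero, one_pow, one_smul]

theorem eq_zero_of_forall_relativeEigenvalues (hδ : δ ∈ Ioo (0 : ℝ) 1) {u : H10 (dom δ)}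
    (h : ∀ l ∈ relativeEigenvalues δ σp σm, ∀ e ∈ pencilEigenspace (A δ σp σm) (A δ 1 1) l,
      A δ 1 1 u e = 0) : u = 0 := by
  have : IsFiniteMeasure (volume.restrict (dom δ)) := ⟨by simpa using volume_dom_lt_top hδ.1⟩
  have hu : IntegrableOn u.1.fst (dom δ) := (Lp.memLp u.1.fst).integrable one_le_two
  exact eq_zero_of_fst_ae_eq_zero (isOpen_dom hδ.1) ((ae_restrict_dom_iff hδ.1).2
    (ae_eq_zero_of_forall_integral_sin_mul_sin hδ (integrableOn_comp_logPolar hδ.1 hu)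
      (integral_sin_mul_sin_smul_eq_zero hδ h)))

end Completeness

/-! ### Injectivity and invertibility -/

section Invertibility

variable {δ σp σm : ℝ} {k : ℕ}

theorem A_one_one_apply (hδ : 0 < δ) (u v : H10 (dom δ)) :
    A δ 1 1 u v = inner ℂ (wgrad v) (wgrad u) := by
  rw [A_apply, L2.inner_def]
  refine integral_congr_ae ((ae_restrict_dom_iff hδ).2 ?_)
  filter_upwards [ae_restrict_mem (measurableSet_rect δ),
    ae_restrict_of_ae (ae_snd_ne (Real.pi / 4))] with p hp hne
  rw [coeff_logPolar hδ 1 1 hp hne, ite_self, Complex.ofReal_one, one_mul]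

theorem exists_pos_mul_sq_le_A_one_one (hδ : 0 < δ) :
    ∃ a > 0, ∀ u : H10 (dom δ), a * ‖u‖ ^ 2 ≤ (A δ 1 1 u u).re := by
  set K := (poincareConst (dom δ)).toReal + 1
  have hK : 0 < K := by positivity
  refine ⟨(K ^ 2)⁻¹, by positivity, fun u => ?_⟩
  rw [A_one_one_apply hδ, inner_self_eq_norm_sq_to_K, inv_mul_le_iff₀ (by positivity)]
  change ‖u‖ ^ 2 ≤ K ^ 2 * (((‖wgrad u‖ : ℝ) : ℂ) ^ 2).re
  rw [← Complex.ofReal_pow, Complex.ofReal_re, ← mul_pow]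
  exact pow_le_pow_left₀ (norm_nonneg u)
    (norm_le_mul_norm_wgrad (volume_dom_lt_top hδ).ne u) 2

theorem surjective_A_one_one (hδ : 0 < δ) : Function.Surjective (A δ 1 1) := by
  obtain ⟨a, ha, hcoer⟩ := exists_pos_mul_sq_le_A_one_one hδ
  obtain ⟨e, he⟩ := isInvertible_of_forall_mul_norm_le (A_apply_conj δ 1 1) ha fun u => by
    rcases (norm_nonneg u).eq_or_lt with hu | hu
    · rw [← hu, mul_zero]
      exact norm_nonneg (A δ 1 1 u)
    · refine le_of_mul_le_mul_right ?_ hu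
      rw [mul_assoc, ← sq]
      exact (hcoer u).trans ((Complex.re_le_norm _).trans ((A δ 1 1 u).le_opNorm u))
  rw [← he]
  exact e.surjective

theorem injective_A (hδ : δ ∈ Ioo (0 : ℝ) 1) (h : 0 ∉ relativeEigenvalues δ σp σm) :
    Function.Injective (A δ σp σm) :=
  injective_of_forall_pencilEigenspace (A_apply_conj δ σp σm) (A_apply_conj δ 1 1)
    (fun _ hl => ne_of_mem_of_not_mem hl h) fun _ => eq_zero_of_forall_relativeEigenvalues hδ

theorem tendsto_cosh_atTop : Tendsto Real.cosh atTop atTop := by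
  refine tendsto_atTop_mono (fun x => ?_) (Real.tendsto_exp_atTop.atTop_div_const two_pos)
  rw [Real.cosh_eq]
  linarith [Real.exp_pos (-x)]

theorem tendsto_interfaceEigenvalue (hδ : δ ∈ Ioo (0 : ℝ) 1) :
    Tendsto (interfaceEigenvalue δ σp σm) atTop (𝓝 ((σp + σm) / 2)) := by
  have hrate : 0 < freq δ 1 * (Real.pi / 2) := mul_pos (freq_pos hδ le_rfl) (by positivity)
  have hfreq : Tendsto (fun k : ℕ => freq δ k * (Real.pi / 2)) atTop atTop := by
    refine (tendsto_natCast_atTop_atTop.atTop_mul_const hrate).congr fun k => ?_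
    rw [freq, freq]
    push_cast
    ring
  have hcosh : Tendsto (fun k : ℕ => 4 * Real.cosh (freq δ k * (Real.pi / 2))) atTop atTop :=
    (tendsto_cosh_atTop.comp hfreq).const_mul_atTop four_pos
  have hlim := (hcosh.const_div_atTop (σp - σm)).const_sub ((σp + σm) / 2)
  rwa [sub_zero] at hlim

theorem exists_pos_le_abs_relativeEigenvalues (hδ : δ ∈ Ioo (0 : ℝ) 1) (hs : σp + σm ≠ 0)
    (h : 0 ∉ relativeEigenvalues δ σp σm) :
    ∃ c > 0, ∀ l ∈ relativeEigenvalues δ σp σm, c ≤ |l| := by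
  have hlim := (tendsto_add_atTop_iff_nat 1).2
    (tendsto_interfaceEigenvalue (σp := σp) (σm := σm) hδ)
  have hclosed : IsClosed (insert ((σp + σm) / 2) (relativeEigenvalues δ σp σm)) := by
    have hrange : interfaceEigenvalue δ σp σm '' Ici 1 =
        range fun k => interfaceEigenvalue δ σp σm (k + 1) := by
      ext l
      exact ⟨fun ⟨k, hk, h⟩ => ⟨k - 1, (congrArg _ (Nat.sub_add_cancel hk)).trans h⟩,
        fun ⟨k, h⟩ => ⟨k + 1, Nat.le_add_left 1 k, h⟩⟩
    rw [relativeEigenvalues, hrange, ← union_insert]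
    exact (toFinite _).isClosed.union hlim.isCompact_insert_range.isClosed
  have hzero : 0 ∉ insert ((σp + σm) / 2) (relativeEigenvalues δ σp σm) := by
    rw [mem_insert_iff, not_or]
    exact ⟨(div_ne_zero hs two_ne_zero).symm, h⟩
  obtain ⟨c, hc, hball⟩ := Metric.mem_nhds_iff.1 (hclosed.isOpen_compl.mem_nhds hzero)
  refine ⟨c, hc, fun l hl => ?_⟩
  by_contra! hlt
  exact hball (mem_ball_zero_iff.2 hlt) (mem_insert_of_mem _ hl)

theorem isInvertible_A (hδ : δ ∈ Ioo (0 : ℝ) 1) (hs : σp + σm ≠ 0)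
    (h : 0 ∉ relativeEigenvalues δ σp σm) : (A δ σp σm).IsInvertible := by
  obtain ⟨a, ha, hcoer⟩ := exists_pos_mul_sq_le_A_one_one hδ.1
  obtain ⟨c, hc, hgap⟩ := exists_pos_le_abs_relativeEigenvalues hδ hs h
  exact isInvertible_of_forall_mul_norm_le (A_apply_conj δ σp σm) (mul_pos hc ha)
    (mul_norm_le_norm_apply_of_dense (A_apply_conj δ σp σm) (A_apply_conj δ 1 1) ha hc hcoer hgap
      (topologicalClosure_iSup_pencilEigenspace (surjective_A_one_one hδ.1)
        fun _ => eq_zero_of_forall_relativeEigenvalues hδ))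

theorem zero_mem_relativeEigenvalues_iff (hp : σp ≠ 0) (hm : σm ≠ 0) :
    0 ∈ relativeEigenvalues δ σp σm ↔ ∃ k, 1 ≤ k ∧ interfaceEigenvalue δ σp σm k = 0 := by
  simp only [relativeEigenvalues, mem_union, mem_insert_iff, mem_singleton_iff, hp.symm, hm.symm,
    or_self, false_or, mem_image, mem_Ici]

theorem exists_ne_zero_A_eq_zero_iff (hδ : δ ∈ Ioo (0 : ℝ) 1) (hp : σp ≠ 0) (hm : σm ≠ 0) :
    (∃ u, u ≠ 0 ∧ A δ σp σm u = 0) ↔ ∃ k, 1 ≤ k ∧ interfaceEigenvalue δ σp σm k = 0 := by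
  refine ⟨fun ⟨u, hu, hAu⟩ => ?_, fun ⟨k, hk, hl⟩ => ?_⟩
  · by_contra hne
    rw [← zero_mem_relativeEigenvalues_iff hp hm] at hne
    exact hu (injective_A hδ hne (hAu.trans (map_zero _).symm))
  · obtain ⟨e, he⟩ := exists_isPolarRep_interface hδ k
    have hmem := mem_pencilEigenspace_interfaceEigenvalue (σp := σp) (σm := σm) hδ he
    rw [hl, mem_pencilEigenspace] at hmem
    refine ⟨e, ne_zero_of_isPolarRep_interface hδ hk he, ContinuousLinearMap.ext fun v => ?_⟩
    rw [hmem, Complex.ofReal_zero, zero_mul, zero_apply]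

theorem isInvertible_A_iff (hδ : δ ∈ Ioo (0 : ℝ) 1) (hp : σp ≠ 0) (hm : σm ≠ 0)
    (hs : σp + σm ≠ 0) :
    (A δ σp σm).IsInvertible ↔ ¬ ∃ k, 1 ≤ k ∧ interfaceEigenvalue δ σp σm k = 0 := by
  refine ⟨fun hinv => ?_, fun h => ?_⟩
  · rw [← exists_ne_zero_A_eq_zero_iff hδ hp hm]
    rintro ⟨u, hu, hAu⟩
    exact hu (hinv.injective (hAu.trans (map_zero _).symm))
  · exact isInvertible_A hδ hs ((zero_mem_relativeEigenvalues_iff hp hm).not.2 h)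

end Invertibility

/-! ### The critical radii -/

section CriticalRadii

variable {δ κ σp σm : ℝ} {k : ℕ}

theorem interfaceEigenvalue_eq_zero_iff (hp : σp ≠ 0) :
    interfaceEigenvalue δ σp σm k = 0 ↔
      2 * Real.cosh (freq δ k * (Real.pi / 2)) * (1 + σm / σp) = 1 - σm / σp := by
  have hC := (Real.cosh_pos (freq δ k * (Real.pi / 2))).ne'
  rw [interfaceEigenvalue]
  field_simp
  constructor <;> intro h <;> linarith

theorem mem_Ioo_of_interfaceEigenvalue_eq_zero (hδ : δ ∈ Ioo (0 : ℝ) 1) (hk : 1 ≤ k)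
    (hp : σp ≠ 0) (h : interfaceEigenvalue δ σp σm k = 0) :
    σm / σp ∈ Ioo (-1 : ℝ) (-1 / 3) := by
  rw [interfaceEigenvalue_eq_zero_iff hp] at h
  have hC : 1 < Real.cosh (freq δ k * (Real.pi / 2)) :=
    Real.one_lt_cosh.2 (mul_pos (freq_pos hδ hk) (by positivity)).ne'
  constructor <;> nlinarith

theorem one_lt_of_mem_Ioo (hκ : κ ∈ Ioo (-1 : ℝ) (-1 / 3)) : 1 < (1 - κ) / (2 * (1 + κ)) := by
  rw [lt_div_iff₀ (by linarith [hκ.1])]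
  linarith [hκ.2]

theorem eq_critDelta_iff (hδ : δ ∈ Ioo (0 : ℝ) 1) (hκ : κ ∈ Ioo (-1 : ℝ) (-1 / 3)) (hk : 1 ≤ k) :
    δ = critDelta κ k ↔ Real.cosh (freq δ k * (Real.pi / 2)) = (1 - κ) / (2 * (1 + κ)) := by
  have hX := one_lt_of_mem_Ioo hκ
  rw [critDelta]
  set X := (1 - κ) / (2 * (1 + κ))
  have harcosh := Real.arcosh_pos hX
  have hlog : 0 < -Real.log δ := neg_pos.2 (Real.log_neg hδ.1 hδ.2)
  have hμ := freq_pos hδ hk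
  have hcosh : Real.cosh (freq δ k * (Real.pi / 2)) = X ↔
      freq δ k * (Real.pi / 2) = Real.arcosh X :=
    ⟨fun h => by rw [← h, Real.arcosh_cosh (by positivity)],
      fun h => by rw [h, Real.cosh_arcosh hX.le]⟩
  have hexp : δ = Real.exp (-(k * Real.pi ^ 2 / (2 * Real.arcosh X))) ↔
      -Real.log δ = k * Real.pi ^ 2 / (2 * Real.arcosh X) :=
    ⟨fun h => by conv_lhs => rw [h, Real.log_exp, neg_neg],
      fun h => by rw [← h, neg_neg, Real.exp_log hδ.1]⟩
  rw [hcosh, hexp, freq, eq_div_iff (by positivity), div_mul_eq_mul_div, div_eq_iff hlog.ne']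
  constructor <;> intro h <;> linarith

theorem interfaceEigenvalue_eq_zero_iff_eq_critDelta (hδ : δ ∈ Ioo (0 : ℝ) 1) (hp : σp ≠ 0)
    (hκ : σm / σp ∈ Ioo (-1 : ℝ) (-1 / 3)) (hk : 1 ≤ k) :
    interfaceEigenvalue δ σp σm k = 0 ↔ δ = critDelta (σm / σp) k := by
  rw [eq_critDelta_iff hδ hκ hk, interfaceEigenvalue_eq_zero_iff hp,
    eq_div_iff (by linarith [hκ.1]), mul_comm 2, mul_assoc]

theorem critDelta_mem_Ioo (hκ : κ ∈ Ioo (-1 : ℝ) (-1 / 3)) (hk : 1 ≤ k) :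
    critDelta κ k ∈ Ioo (0 : ℝ) 1 := by
  have harcosh := Real.arcosh_pos (one_lt_of_mem_Ioo hκ)
  exact ⟨Real.exp_pos _, Real.exp_lt_one_iff.2 (neg_neg_of_pos (by positivity))⟩

theorem tendsto_critDelta (hκ : κ ∈ Ioo (-1 : ℝ) (-1 / 3)) :
    Tendsto (critDelta κ) atTop (𝓝 0) := by
  have harcosh := Real.arcosh_pos (one_lt_of_mem_Ioo hκ)
  refine Real.tendsto_exp_atBot.comp (tendsto_neg_atTop_atBot.comp ?_)
  exact (tendsto_natCast_atTop_atTop.atTop_mul_const (by positivity)).atTop_div_const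
    (by positivity)

end CriticalRadii

end HalfAnnulus

end

theorem mainTheorem9_general (σp σm : ℝ) (hp : σp ≠ 0) (hm : σm ≠ 0) :
    (σm / σp ∈ Ioo (-1 : ℝ) (-1 / 3) →
      (∀ n : ℕ, 1 ≤ n → HalfAnnulus.critDelta (σm / σp) n ∈ Ioo (0 : ℝ) 1) ∧
      Tendsto (HalfAnnulus.critDelta (σm / σp)) atTop (𝓝 0) ∧
      ∀ δ ∈ Ioo (0 : ℝ) 1,
        ((∃ u : HalfAnnulus.H10 (HalfAnnulus.dom δ), u ≠ 0 ∧ HalfAnnulus.A δ σp σm u = 0) ↔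
          ∃ n : ℕ, 1 ≤ n ∧ δ = HalfAnnulus.critDelta (σm / σp) n) ∧
        ((HalfAnnulus.A δ σp σm).IsInvertible ↔
          ¬ ∃ n : ℕ, 1 ≤ n ∧ δ = HalfAnnulus.critDelta (σm / σp) n)) ∧
    (σm / σp ∉ Ioo (-1 : ℝ) (-1 / 3) →
      ∀ δ ∈ Ioo (0 : ℝ) 1, Function.Injective (HalfAnnulus.A δ σp σm) ∧
        (σm / σp ≠ -1 → (HalfAnnulus.A δ σp σm).IsInvertible)) := by
  have hsum (hκ : σm / σp ≠ -1) : σp + σm ≠ 0 := fun h => hκ <| by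
    rw [eq_neg_of_add_eq_zero_right h, neg_div, div_self hp]
  refine ⟨fun hκ => ⟨fun n => HalfAnnulus.critDelta_mem_Ioo hκ, HalfAnnulus.tendsto_critDelta hκ,
    fun δ hδ => ?_⟩, fun hκ δ hδ => ?_⟩
  · have hcrit : (∃ n, 1 ≤ n ∧ HalfAnnulus.interfaceEigenvalue δ σp σm n = 0) ↔
        ∃ n, 1 ≤ n ∧ δ = HalfAnnulus.critDelta (σm / σp) n :=
      exists_congr fun n => and_congr_right
        (HalfAnnulus.interfaceEigenvalue_eq_zero_iff_eq_critDelta hδ hp hκ)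
    rw [← hcrit]
    exact ⟨HalfAnnulus.exists_ne_zero_A_eq_zero_iff hδ hp hm,
      HalfAnnulus.isInvertible_A_iff hδ hp hm (hsum hκ.1.ne')⟩
  · have hzero : 0 ∉ HalfAnnulus.relativeEigenvalues δ σp σm :=
      (HalfAnnulus.zero_mem_relativeEigenvalues_iff hp hm).not.2 fun ⟨_, hn, h⟩ =>
        hκ (HalfAnnulus.mem_Ioo_of_interfaceEigenvalue_eq_zero hδ hn hp h)
    exact ⟨HalfAnnulus.injective_A hδ hzero, fun h => HalfAnnulus.isInvertible_A hδ (hsum h) hzero⟩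

theorem mainTheorem9 (σp σm : ℝ) (hp : 0 < σp) (hm : σm < 0) :
    (σm / σp ∈ Ioo (-1 : ℝ) (-1 / 3) →
      (∀ n : ℕ, 1 ≤ n → HalfAnnulus.critDelta (σm / σp) n ∈ Ioo (0 : ℝ) 1) ∧
      Tendsto (HalfAnnulus.critDelta (σm / σp)) atTop (𝓝 0) ∧
      ∀ δ ∈ Ioo (0 : ℝ) 1,
        ((∃ u : HalfAnnulus.H10 (HalfAnnulus.dom δ), u ≠ 0 ∧ HalfAnnulus.A δ σp σm u = 0) ↔
          ∃ n : ℕ, 1 ≤ n ∧ δ = HalfAnnulus.critDelta (σm / σp) n) ∧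
        ((HalfAnnulus.A δ σp σm).IsInvertible ↔
          ¬ ∃ n : ℕ, 1 ≤ n ∧ δ = HalfAnnulus.critDelta (σm / σp) n)) ∧
    (σm / σp ∉ Icc (-1 : ℝ) (-1 / 3) →
      ∀ δ ∈ Ioo (0 : ℝ) 1, Function.Injective (HalfAnnulus.A δ σp σm)) :=
  (mainTheorem9_general σp σm hp.ne' hm.ne).imp_right fun h hκ δ hδ =>
    (h (fun hmem => hκ (Ioo_subset_Icc_self hmem)) δ hδ).1
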